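/- Let $(S,\mathscr S)$ be a measurable space, $\nu$ a probability measure on $S$ and $\mathcal P$ a probability kernel from $S$ to $S^2$. Put $\mathcal Pg(x)=\int g(x,y,z)\,\mathcal P(x,dy,dz)$ for $g$ on $S^3$, $\mathcal Ph(x)=\int h(y,z)\,\mathcal P(x,dy,dz)$ for $h$ on $S^2$, let $\mathcal Q=\frac12(P_0+P_1)$, where $P_0,P_1$ are the two marginal kernels of $\mathcal P$, and $\langle\lambda,f\rangle=\int f\,d\lambda$. Let $\mathbb G_k=\{0,1\}^k$, $\mathbb T=\bigcup_{k\ge0}\mathbb G_k$ (with root $\emptyset$), $\mathbb T_k=\bigcup_{r\le k}\mathbb G_r$. Let $X=(X_u,u\in\mathbb T)$ be a bifurcating Markov chain with initial law $\nu$ and kernel $\mathcal P$: $X_\emptyset\sim\nu$ and, for all bounded measurable functions $(g_u,u\in\mathbb T)$ on $S^3$ and all $k\ge0$, $$\mathbb E\Big[\prod_{u\in\mathbb G_k}g_u(X_u,X_{u0},X_{u1})\,\Big|\,\sigma(X_v;v\in\mathbb T_k)\Big]=\prod_{u\in\mathbb G_k}\mathcal Pg_u(X_u)\quad\text{a.s.}$$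 Let $F$ be a real vector space of real measurable functions on $S$ such that: $F$ contains the constants; $f^2\in F$ for $f\in F$; $F\subset L^1(\nu)$; and for all $f,g\in F$, $f\otimes g:(y,z)\mapsto f(y)g(z)$ belongs to $L^1(\mathcal P(x,\cdot))$ for every $x\in S$ and $\mathcal P(f\otimes g)\in F$. Assume the second spectral gap: there are a probability measure $\mu$ on $S$ with $F\subset L^1(\mu)$, a number $\alpha\in(0,1)$, a finite non-empty set $J$, distinct complex eigenvalues $\alpha_j$ ($j\in J$) of $\mathcal Q$ acting on $\mathbb CF$ (the complex span of $F$) with $|\alpha_j|=\alpha$, non-zero linear projectors $\mathcal R_j$ of $\mathbb CF$ with $\mathcal R_j\mathcal R_{j'}=0$ for $j\ne j'$, and a positive non-increasing sequence $(\beta_n)$ bounded by $1$ and converging to $0$, such that, with $\theta_j=\alpha_j/\alpha$, for every $f\in F$ there is $g\in F$ with $$\Big|\mathcal Q^nf-\langle\mu,f\rangle-\alpha^n\sum_{j\in J}\theta_j^n\mathcal R_j(f)\Big|\le\beta_n\alpha^ng\qquad\text{for all }n\in\mathbb N.$$ Assume moreover that $\alpha>1/\sqrt2$. (a) For all $j\in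 J$ and $f\in F$, the sequence $M_{n,j}(f)=(2\alpha_j)^{-n}\sum_{u\in\mathbb G_n}\mathcal R_j(f)(X_u)$, $n\in\mathbb N$, is a square-integrable martingale with respect to the filtration $(\sigma(X_v;v\in\mathbb T_n))_{n\in\mathbb N}$, and it converges almost surely and in $L^2$ to a random variable $M_{\infty,j}(f)$. (b) Let $\mathfrak f=(f_\ell,\ell\in\mathbb N)$ be a sequence of real measurable functions on $S^3$ such that for all $\ell$, $\mathcal P f_\ell$ and $\mathcal P(f_\ell^2)$ exist (as finite integrals at every point) and belong to $F$. Suppose that each of the two sequences $(h_\ell)=(\mathcal Pf_\ell)$ and $(h_\ell)=(\mathcal P(f_\ell^2))$ satisfies, for some $g\in F$ and with $\tilde h=h-\langle\mu,h\rangle$ and $\hat h=\tilde h-\sum_{j\in J}\mathcal R_j(h)$, $$|\mathcal Q^nh_\ell|\le g,\qquad|\mathcal Q^n\tilde h_\ell|\le\alpha^ng,\qquad|\mathcal Q^n\hat h_\ell|\le\beta_n\alpha^ng\qquad\text{for all }n,\ell\in\mathbb N.$$ Let $$N_{n,\emptyset}(\mathfrak f)=|\mathbb G_n|^{-1/2}\sum_{\ell=0}^n\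 \sum_{u\in\mathbb G_{n-\ell}}\big(f_\ell(X_u,X_{u0},X_{u1})-\langle\mu,\mathcal Pf_\ell\rangle\big).$$ Then, almost surely, the series below converges absolutely for every $n$, and $$(2\alpha^2)^{-n/2}N_{n,\emptyset}(\mathfrak f)-\sum_{\ell\in\mathbb N}(2\alpha)^{-\ell}\sum_{j\in J}\theta_j^{\,n-\ell}M_{\infty,j}(\mathcal Pf_\ell)\ \longrightarrow\ 0\quad\text{in probability as }n\to\infty.$$ -/

import Mathlib

open MeasureTheory ProbabilityTheory Filter Topology
open scoped ENNReal

namespace BMC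

/-! ### The binary tree -/

/-- The complete binary tree: finite words in `{0, 1}`; the root is `[]`, and the daughters of `u`
are `u0 = u ++ [false]` and `u1 = u ++ [true]`. -/
abbrev Tree : Type := List Bool

/-- The `k`-th generation `{0, 1} ^ k`. -/
def gen (k : ℕ) : Finset Tree :=
  (Finset.univ : Finset (Fin k → Bool)).image List.ofFn

theorem mem_gen {k : ℕ} {u : Tree} : u ∈ gen k ↔ u.length = k := by
  constructor
  · intro h
    obtain ⟨v, -, rfl⟩ := Finset.mem_image.1 h
    exact List.length_ofFn
  · rintro rfl
    exact Finset.mem_image.2 ⟨u.get, Finset.mem_univ _, List.ofFn_get u⟩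

section

variable {S Ω : Type*} [MeasurableSpace S] [MeasurableSpace Ω]

/-- The mother-daughters triangle `(X_u, X_{u0}, X_{u1})`. -/
def triangle (X : Tree → Ω → S) (u : Tree) (ω : Ω) : S × S × S :=
  (X u ω, X (u ++ [false]) ω, X (u ++ [true]) ω)

/-- The sigma-field generated by `X_u`, for `u` in the tree up to generation `k`. -/
abbrev treeSigma (X : Tree → Ω → S) (k : ℕ) : MeasurableSpace Ω :=
  ⨆ u : {u : Tree // u.length ≤ k}, MeasurableSpace.comap (X u) inferInstance

/-- The filtration of the generations of the tree. -/
def treeFiltration (X : Tree → Ω → S) (hX : ∀ u, Measurable (X u)) :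
    Filtration ℕ (inferInstance : MeasurableSpace Ω) where
  seq := treeSigma X
  mono' := fun _ n hkn => iSup_le fun u =>
    le_iSup (fun v : {v : Tree // v.length ≤ n} => MeasurableSpace.comap (X v) inferInstance)
      ⟨u.1, u.2.trans hkn⟩
  le' := fun _ => iSup_le fun u => (hX u).comap_le

/-! ### Kernels and their action on functions -/

/-- `(P g)(x) = ∫ g(x, y, z) P(x, dy, dz)` for a function `g` of three variables. -/
noncomputable def actTriple (P : Kernel S (S × S)) (g : S × S × S → ℝ) (x : S) : ℝ :=
  ∫ p, g (x, p) ∂(P x)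

/-- `(P h)(x) = ∫ h(y, z) P(x, dy, dz)` for a function `h` of two variables. -/
noncomputable def actPair (P : Kernel S (S × S)) (h : S × S → ℝ) (x : S) : ℝ :=
  ∫ p, h p ∂(P x)

/-- The induced kernel `Q = (P_0 + P_1) / 2`, where `P_0` and `P_1` are the marginals of `P`. -/
noncomputable def inducedKernel (P : Kernel S (S × S)) : Kernel S S where
  toFun x := (2⁻¹ : ℝ≥0∞) • (P.fst x + P.snd x)
  measurable' := by
    refine Measure.measurable_of_measurable_coe _ fun s hs => ?_
    simp only [Measure.smul_apply, Measure.add_apply, smul_eq_mul]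
    exact ((Kernel.measurable_coe _ hs).add (Kernel.measurable_coe _ hs)).const_mul _

/-- The operator `(Q f)(x) = ∫ f(y) Q(x, dy)`, on real or complex functions. Its `n`-th iterate is
written `(actQ P)^[n]`. -/
noncomputable def actQ {E : Type*} [NormedAddCommGroup E] [NormedSpace ℝ E]
    (P : Kernel S (S × S)) (f : S → E) (x : S) : E :=
  ∫ y, f y ∂(inducedKernel P x)

/-! ### Bifurcating Markov chains -/

/-- `X` is a bifurcating Markov chain with initial law `ν` and kernel `P`. -/
structure IsBMC (ρ : Measure Ω) (ν : Measure S) (P : Kernel S (S × S)) (X : Tree → Ω → S) :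
    Prop where
  measurable : ∀ u, Measurable (X u)
  initial : ρ.map (X []) = ν
  branching : ∀ g : Tree → S × S × S → ℝ, (∀ u, Measurable (g u)) →
    (∀ u, ∃ C : ℝ, ∀ t, |g u t| ≤ C) → ∀ k : ℕ,
      ρ[fun ω => ∏ u ∈ gen k, g u (triangle X u ω) | treeSigma X k]
        =ᵐ[ρ] fun ω => ∏ u ∈ gen k, actTriple P (g u) (X u ω)

/-! ### Assumptions -/

/-- The structural assumption on the vector space `F` of test functions. -/
structure IsTestSpace (ν : Measure S) (P : Kernel S (S × S)) (F : Submodule ℝ (S → ℝ)) :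
    Prop where
  measurable : ∀ f ∈ F, Measurable f
  const_mem : ∀ c : ℝ, (fun _ => c) ∈ F
  sq_mem : ∀ f ∈ F, (fun x => f x ^ 2) ∈ F
  integrable_initial : ∀ f ∈ F, Integrable f ν
  integrable_tensor : ∀ f ∈ F, ∀ g ∈ F, ∀ x, Integrable (fun p : S × S => f p.1 * g p.2) (P x)
  tensor_mem : ∀ f ∈ F, ∀ g ∈ F, actPair P (fun p => f p.1 * g p.2) ∈ F

/-- A real function seen as a complex function. -/
def toComplex (f : S → ℝ) : S → ℂ := fun x => (f x : ℂ)

/-- `ℂF`, the complex vector space spanned by `F`. -/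
def complexSpan (F : Submodule ℝ (S → ℝ)) : Submodule ℂ (S → ℂ) :=
  Submodule.span ℂ (toComplex '' (F : Set (S → ℝ)))

/-- An element of `F` seen as an element of `ℂF`. -/
def inSpan {F : Submodule ℝ (S → ℝ)} (f : F) : complexSpan F :=
  ⟨toComplex f, Submodule.subset_span ⟨f, f.2, rfl⟩⟩

/-- The function `R_j f`, for `f` in `F`. -/
def proj {J : Type*} {F : Submodule ℝ (S → ℝ)} (R : J → Module.End ℂ (complexSpan F)) (j : J)
    (f : F) : S → ℂ :=
  (R j (inSpan f) : S → ℂ)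

/-- `θ_j = α_j / α`. -/
noncomputable def theta {J : Type*} (α : ℝ) (a : J → ℂ) (j : J) : ℂ := a j / (α : ℂ)

/-- The assumption of a second spectral gap, with rate `α`, eigenvalues `a j`, projectors `R j` and
rate of the remainder `β`. -/
structure SecondSpectralGap {J : Type*} [Fintype J] (P : Kernel S (S × S))
    (F : Submodule ℝ (S → ℝ)) (μ : Measure S) (α : ℝ) (a : J → ℂ)
    (R : J → Module.End ℂ (complexSpan F)) (β : ℕ → ℝ) : Prop where
  prob : IsProbabilityMeasure μ
  integrable : ∀ f ∈ F, Integrable f μ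
  rate_pos : 0 < α
  rate_lt_one : α < 1
  nonempty : Nonempty J
  injective : Function.Injective a
  norm_eq : ∀ j, ‖a j‖ = α
  eigenvalue : ∀ j, ∃ h ∈ complexSpan F, h ≠ 0 ∧ actQ P h = a j • h
  proj_ne_zero : ∀ j, R j ≠ 0
  proj_idem : ∀ j, R j ∘ₗ R j = R j
  proj_orth : ∀ i j, i ≠ j → R i ∘ₗ R j = 0
  beta_pos : ∀ n, 0 < β n
  beta_anti : Antitone β
  beta_le_one : ∀ n, β n ≤ 1
  beta_tendsto : Tendsto β atTop (𝓝 0)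
  gap : ∀ f : F, ∃ g ∈ F, ∀ (n : ℕ) (x : S),
    ‖(((actQ P)^[n] (f : S → ℝ) x : ℝ) : ℂ) - ((∫ y, (f : S → ℝ) y ∂μ : ℝ) : ℂ)
        - (α : ℂ) ^ n * ∑ j, theta α a j ^ n * proj R j f x‖ ≤ β n * α ^ n * g x

/-- `f - ⟨μ, f⟩`, for a function of one variable. -/
noncomputable def centered (μ : Measure S) (f : S → ℝ) : S → ℝ := fun x => f x - ∫ y, f y ∂μ

/-- `f - ⟨μ, f⟩ - ∑ j, R_j f`. -/
noncomputable def hat {J : Type*} [Fintype J] {F : Submodule ℝ (S → ℝ)} (μ : Measure S)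
    (R : J → Module.End ℂ (complexSpan F)) (f : F) : S → ℂ :=
  fun x => (centered μ f x : ℂ) - ∑ j, proj R j f x

/-- The sequence `h` of elements of `F` satisfies the second spectral gap assumption uniformly. -/
def UniformGap {J : Type*} [Fintype J] {F : Submodule ℝ (S → ℝ)} (P : Kernel S (S × S))
    (μ : Measure S) (α : ℝ) (R : J → Module.End ℂ (complexSpan F)) (β : ℕ → ℝ)
    (h : ℕ → F) : Prop :=
  ∃ g ∈ F, ∀ (n l : ℕ) (x : S),
    |(actQ P)^[n] (h l : S → ℝ) x| ≤ g x ∧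
    |(actQ P)^[n] (centered μ (h l)) x| ≤ α ^ n * g x ∧
    ‖(actQ P)^[n] (hat μ R (h l)) x‖ ≤ β n * α ^ n * g x

/-! ### The fluctuations and the martingales -/

/-- `N_{n,∅}(𝔣) = |G_n| ^ (-1/2) ∑_{l ≤ n} ∑_{u ∈ G_{n-l}} (f_l(X_u, X_{u0}, X_{u1}) - ⟨μ, P f_l⟩)`. -/
noncomputable def fluct (P : Kernel S (S × S)) (μ : Measure S) (X : Tree → Ω → S)
    (f : ℕ → S × S × S → ℝ) (n : ℕ) (ω : Ω) : ℝ :=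
  ((gen n).card : ℝ) ^ (-(1 / 2) : ℝ) *
    ∑ l ∈ Finset.range (n + 1), ∑ u ∈ gen (n - l),
      (f l (triangle X u ω) - ∫ x, actTriple P (f l) x ∂μ)

/-- `M_{n,j}(f) = (2 α_j) ^ (-n) ∑_{u ∈ G_n} (R_j f)(X_u)`. -/
noncomputable def mart {J : Type*} {F : Submodule ℝ (S → ℝ)} (X : Tree → Ω → S) (a : J → ℂ)
    (R : J → Module.End ℂ (complexSpan F)) (j : J) (f : F) (n : ℕ) (ω : Ω) : ℂ :=
  ((2 * a j) ^ n)⁻¹ * ∑ u ∈ gen n, proj R j f (X u ω)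

/-- `M_{∞,j}(f)`, the pointwise limit of `M_{n,j}(f)` as `n → ∞`. -/
noncomputable def martLim {J : Type*} {F : Submodule ℝ (S → ℝ)} (X : Tree → Ω → S) (a : J → ℂ)
    (R : J → Module.End ℂ (complexSpan F)) (j : J) (f : F) (ω : Ω) : ℂ :=
  limUnder atTop fun n => mart X a R j f n ω

/-- `(2 α) ^ (-l) ∑ j, θ_j ^ (n - l) M_{∞,j}(h_l)`. -/
noncomputable def limTerm {J : Type*} [Fintype J] {F : Submodule ℝ (S → ℝ)} (X : Tree → Ω → S)
    (α : ℝ) (a : J → ℂ) (R : J → Module.End ℂ (complexSpan F)) (h : ℕ → F) (n : ℕ) (ω : Ω)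
    (l : ℕ) : ℂ :=
  ((2 * (α : ℂ)) ^ l)⁻¹ * ∑ j, theta α a j ^ ((n : ℤ) - (l : ℤ)) * martLim X a R j (h l) ω

end

end BMC

/-! ### Generations of the binary tree -/

namespace BMC

/-! Two growth rates compete. Given the past, the `2 ^ k` triangles of generation `k` are
independent, so the conditionally centred part of a generation sum has `L²` norm of order `√2 ^ k`.
The drift multiplies an eigenfunction of `Q` for `α_j` by `2 α_j`, of modulus `2 α`. The condition
`α > 1/√2` says exactly that `√2 / (2 α) < 1`: drift beats noise.

Part (a). The gap forces `Q R_j f = α_j R_j f` (`qEnd_proj`): applying `Q` to the expansion at time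
`n` and comparing with time `n + 1` gives a combination of the `θ_j ^ n` tending to `0`, and
averaging isolates each coefficient (`norm_coeff_le_of_norm_sum_le`). Hence `M_{n,j}(f)` is a
martingale, and its increments are `O((√2 / (2 α)) ^ n)` in `L²`, which gives both modes of
convergence.

Part (b). On generation `k`, `f_ℓ - ⟨μ, P f_ℓ⟩` splits into `f_ℓ - P f_ℓ` (noise, `√2 ^ k`), the hat
part of `P f_ℓ` (which is `o((2 α) ^ k)` by the gap, `exists_eLpNorm_genSum_le`), and `∑ j, R_j (P
f_ℓ)`, whose sum is `(2 α) ^ k ∑ j, θ_j ^ k M_{k,j}`. After division by `(2 α) ^ k` the sum is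
within `b_k → 0` of `∑ j, θ_j ^ k M_{∞,j}` in `L²`, uniformly in `ℓ`
(`exists_eLpNorm_normalized_sub_le`). The prefactors of `N_{n,∅}` amount to `(2 α) ^ (-n)`, so with
`k = n - ℓ` the total error is bounded by the convolution of the summable `(2 α) ^ (-ℓ)` with the
null sequence `b`. The terms `ℓ > n` of the series form a tail that vanishes in `L¹`. -/

theorem card_gen (k : ℕ) : (gen k).card = 2 ^ k := by
  rw [gen, Finset.card_image_of_injective _ List.ofFn_injective]
  simp

theorem sum_gen_succ {M : Type*} [AddCommMonoid M] (φ : Tree → M) (k : ℕ) :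
    ∑ u ∈ gen (k + 1), φ u = ∑ u ∈ gen k, (φ (u ++ [false]) + φ (u ++ [true])) := by
  have h : ∀ u : Tree, φ (u ++ [false]) + φ (u ++ [true]) = ∑ b : Bool, φ (u ++ [b]) := by
    intro u
    rw [Fintype.sum_bool, add_comm]
  simp_rw [h]
  rw [← Finset.sum_product']
  symm
  refine Finset.sum_bij (fun p _ => p.1 ++ [p.2]) ?_ ?_ ?_ ?_
  · intro p hp
    simp only [Finset.mem_product, mem_gen] at hp ⊢
    simp [hp.1]
  · rintro ⟨u, b⟩ - ⟨v, c⟩ - huv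
    obtain ⟨h1, h2⟩ := List.append_inj' huv rfl
    simp_all
  · intro u hu
    rw [mem_gen] at hu
    have hne : u ≠ [] := by rintro rfl; simp at hu
    refine ⟨(u.dropLast, u.getLast hne), ?_, List.dropLast_append_getLast hne⟩
    simp [mem_gen, hu]
  · intros; rfl

theorem gen_zero : gen 0 = {[]} := by
  ext u
  simp [mem_gen]

/-! ### Law of a triangle given the past -/

section

variable {S Ω : Type*} [MeasurableSpace S]

theorem treeSigma_le [mΩ : MeasurableSpace Ω] {X : Tree → Ω → S} (hX : ∀ u, Measurable (X u)) (k : ℕ) :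
    treeSigma X k ≤ mΩ :=
  iSup_le fun u => (hX u).comap_le

theorem measurable_treeSigma (X : Tree → Ω → S) {u : Tree} {k : ℕ} (hu : u.length ≤ k) :
    Measurable[treeSigma X k] (X u) :=
  Measurable.mono (comap_measurable (X u))
    (le_iSup (fun v : {v : Tree // v.length ≤ k} => MeasurableSpace.comap (X v) inferInstance)
      ⟨u, hu⟩) le_rfl

variable [MeasurableSpace Ω]

theorem measurable_triangle {X : Tree → Ω → S} (hX : ∀ u, Measurable (X u)) (u : Tree) :
    Measurable (triangle X u) :=
  (hX u).prodMk ((hX _).prodMk (hX _))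

theorem actTriple_const (P : Kernel S (S × S)) [IsMarkovKernel P] (c : ℝ) (x : S) :
    actTriple P (fun _ => c) x = c := by
  simp [actTriple]

theorem measurable_actTriple (P : Kernel S (S × S)) [IsMarkovKernel P] {g : S × S × S → ℝ}
    (hg : Measurable g) : Measurable (actTriple P g) :=
  (hg.stronglyMeasurable.integral_kernel_prod_right' (κ := P)).measurable

theorem abs_actTriple_le (P : Kernel S (S × S)) [IsMarkovKernel P] {g : S × S × S → ℝ} {C : ℝ}
    (hg : ∀ t, |g t| ≤ C) (x : S) : |actTriple P g x| ≤ C := by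
  have := norm_integral_le_of_norm_le_const (μ := P x) (f := fun p => g (x, p)) (C := C)
    (Eventually.of_forall fun p => hg (x, p))
  simpa [actTriple] using this

variable {ρ : Measure Ω} {ν : Measure S} {P : Kernel S (S × S)} [IsMarkovKernel P]
  {X : Tree → Ω → S}

/-- The branching property for a single triangle. -/
theorem IsBMC.condExp_triangle (hX : IsBMC ρ ν P X) {g : S × S × S → ℝ} (hg : Measurable g)
    {C : ℝ} (hC : ∀ t, |g t| ≤ C) (u : Tree) :
    ρ[fun ω => g (triangle X u ω) | treeSigma X u.length]
      =ᵐ[ρ] fun ω => actTriple P g (X u ω) := by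
  classical
  -- Test functions equal to `1` away from `u` contribute a factor `1` on both sides, because `P` is
  -- Markov.
  have h := hX.branching (fun w => if w = u then g else fun _ => 1)
    (fun w => by split_ifs <;> [exact hg; exact measurable_const])
    (fun w => by
      split_ifs
      · exact ⟨C, hC⟩
      · exact ⟨1, fun t => by simp⟩) u.length
  have e1 : ∀ ω, ∏ w ∈ gen u.length,
      (if w = u then g else fun _ => 1) (triangle X w ω) = g (triangle X u ω) := fun ω => by
    rw [Finset.prod_eq_single u (fun w _ hw => by simp [hw])
      (fun hu => absurd (mem_gen.2 rfl) hu)]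
    simp
  have e2 : ∀ ω, ∏ w ∈ gen u.length,
      actTriple P (if w = u then g else fun _ => 1) (X w ω) = actTriple P g (X u ω) := fun ω => by
    rw [Finset.prod_eq_single u (fun w _ hw => by simp [hw, actTriple_const])
      (fun hu => absurd (mem_gen.2 rfl) hu)]
    simp
  simpa only [e1, e2] using h

variable [IsProbabilityMeasure ρ]

/-- Distinct triangles of the same generation are conditionally independent. -/
theorem IsBMC.integral_mul_triangle (hX : IsBMC ρ ν P X) {g : S × S × S → ℝ} (hg : Measurable g)
    {C : ℝ} (hC : ∀ t, |g t| ≤ C) {u v : Tree} (huv : u ≠ v) (hl : u.length = v.length) :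
    ∫ ω, g (triangle X u ω) * g (triangle X v ω) ∂ρ
      = ∫ ω, actTriple P g (X u ω) * actTriple P g (X v ω) ∂ρ := by
  classical
  have h := hX.branching (fun w => if w = u ∨ w = v then g else fun _ => 1)
    (fun w => by split_ifs <;> [exact hg; exact measurable_const])
    (fun w => by
      split_ifs
      · exact ⟨C, hC⟩
      · exact ⟨1, fun t => by simp⟩) u.length
  have e1 : ∀ ω, ∏ w ∈ gen u.length, (if w = u ∨ w = v then g else fun _ => 1) (triangle X w ω)
      = g (triangle X u ω) * g (triangle X v ω) := fun ω => by
    rw [Finset.prod_eq_mul u v huv (fun w _ hw => by simp [hw])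
      (fun hu => absurd (mem_gen.2 rfl) hu) (fun hu => absurd (mem_gen.2 hl.symm) hu)]
    simp
  have e2 : ∀ ω, ∏ w ∈ gen u.length,
      actTriple P (if w = u ∨ w = v then g else fun _ => 1) (X w ω)
      = actTriple P g (X u ω) * actTriple P g (X v ω) := fun ω => by
    rw [Finset.prod_eq_mul u v huv (fun w _ hw => by simp [hw, actTriple_const])
      (fun hu => absurd (mem_gen.2 rfl) hu) (fun hu => absurd (mem_gen.2 hl.symm) hu)]
    simp
  simp only [e1, e2] at h
  rw [← integral_congr_ae h, integral_condExp (treeSigma_le hX.measurable _)]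

/-- The joint law of a triangle, restricted to an event of the past. -/
theorem IsBMC.map_triangle_restrict (hX : IsBMC ρ ν P X) (u : Tree) {A : Set Ω}
    (hA : MeasurableSet[treeSigma X u.length] A) :
    (ρ.restrict A).map (triangle X u) = ((ρ.restrict A).map (X u)) ⊗ₘ P := by
  have hle := treeSigma_le hX.measurable u.length
  have hT := measurable_triangle hX.measurable u
  refine Measure.ext fun s hs => ?_
  -- Indicators are bounded, so the branching property applies to them, and they determine the
  -- measure.
  have hg : Measurable (s.indicator (fun _ => (1 : ℝ))) := measurable_const.indicator hs
  have hC : ∀ t, |s.indicator (fun _ => (1 : ℝ)) t| ≤ 1 := fun t => by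
    by_cases ht : t ∈ s <;> simp [ht]
  have h1 := hX.condExp_triangle hg hC u
  have hint : Integrable (fun ω => s.indicator (fun _ => (1 : ℝ)) (triangle X u ω)) ρ :=
    Integrable.of_bound (hg.comp hT).aestronglyMeasurable 1 (Eventually.of_forall fun ω => hC _)
  have h2 := setIntegral_condExp hle hint hA
  rw [setIntegral_congr_ae (hle _ hA) (h1.mono fun ω h _ => h)] at h2
  have e1 : ∀ x, actTriple P (s.indicator fun _ => (1 : ℝ)) x = (P x).real (Prod.mk x ⁻¹' s) := by
    intro x
    have : (fun p => s.indicator (fun _ => (1 : ℝ)) (x, p))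
        = (Prod.mk x ⁻¹' s).indicator 1 := by
      rfl
    rw [actTriple, this, integral_indicator_one (measurable_prodMk_left hs)]
  have e2 : (fun ω => s.indicator (fun _ => (1 : ℝ)) (triangle X u ω))
      = (triangle X u ⁻¹' s).indicator 1 := by
    rfl
  rw [e2, integral_indicator_one (hT hs)] at h2
  rw [Measure.map_apply hT hs, Measure.compProd_apply hs,
    lintegral_map (Kernel.measurable_kernel_prodMk_left hs) (hX.measurable u),
    ← ENNReal.ofReal_toReal (measure_ne_top (ρ.restrict A) _)]
  have h3 : ((ρ.restrict A) (triangle X u ⁻¹' s)).toReal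
      = ∫ ω in A, (P (X u ω)).real (Prod.mk (X u ω) ⁻¹' s) ∂ρ := by
    rw [← measureReal_def, ← h2]
    simp only [e1]
  rw [h3, ofReal_integral_eq_lintegral_ofReal]
  · simp [measureReal_def]
  · refine Integrable.of_bound ?_ 1 (Eventually.of_forall fun ω => ?_)
    · exact (((Kernel.measurable_kernel_prodMk_left hs).ennreal_toReal).comp
        (hX.measurable u)).aestronglyMeasurable
    · rw [Real.norm_of_nonneg measureReal_nonneg]
      exact measureReal_le_one
  · exact Eventually.of_forall fun ω => measureReal_nonneg

theorem IsBMC.map_triangle (hX : IsBMC ρ ν P X) (u : Tree) :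
    ρ.map (triangle X u) = (ρ.map (X u)) ⊗ₘ P := by
  simpa using hX.map_triangle_restrict u (A := Set.univ) MeasurableSet.univ

theorem IsBMC.lintegral_triangle (hX : IsBMC ρ ν P X) (u : Tree) {φ : S × S × S → ℝ≥0∞}
    (hφ : Measurable φ) :
    ∫⁻ ω, φ (triangle X u ω) ∂ρ = ∫⁻ ω, ∫⁻ p, φ (X u ω, p) ∂(P (X u ω)) ∂ρ := by
  rw [← lintegral_map hφ (measurable_triangle hX.measurable u), hX.map_triangle,
    Measure.lintegral_compProd hφ,
    lintegral_map hφ.lintegral_kernel_prod_right' (hX.measurable u)]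

/-- The branching property concerns bounded real functions only; identifying the joint law on past
events extends its one-triangle form to all integrable vector-valued functions. -/
theorem IsBMC.setIntegral_triangle {E : Type*} [NormedAddCommGroup E] [NormedSpace ℝ E]
    (hX : IsBMC ρ ν P X) (u : Tree) {φ : S × S × S → E} (hφ : StronglyMeasurable φ)
    (hi : Integrable (fun ω => φ (triangle X u ω)) ρ) {A : Set Ω}
    (hA : MeasurableSet[treeSigma X u.length] A) :
    ∫ ω in A, φ (triangle X u ω) ∂ρ = ∫ ω in A, ∫ p, φ (X u ω, p) ∂(P (X u ω)) ∂ρ := by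
  have hT := measurable_triangle hX.measurable u
  have hi' : Integrable φ ((ρ.restrict A).map (triangle X u)) :=
    (integrable_map_measure hφ.aestronglyMeasurable hT.aemeasurable).2 hi.integrableOn
  rw [← integral_map hT.aemeasurable hφ.aestronglyMeasurable, hX.map_triangle_restrict u hA,
    Measure.integral_compProd (by rwa [hX.map_triangle_restrict u hA] at hi'),
    integral_map (hX.measurable u).aemeasurable]
  exact hφ.integral_kernel_prod_right'.aestronglyMeasurable

end

/-! ### Conditional variance of a sum over a generation -/

section

variable {S Ω : Type*} [MeasurableSpace S] [MeasurableSpace Ω] {ρ : Measure Ω}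
  [IsProbabilityMeasure ρ] {ν : Measure S} {P : Kernel S (S × S)} [IsMarkovKernel P]
  {X : Tree → Ω → S}

theorem integrable_of_abs_le {α : Type*} [MeasurableSpace α] {m : Measure α} [IsFiniteMeasure m]
    {g : α → ℝ} (hg : Measurable g) {C : ℝ} (hC : ∀ t, |g t| ≤ C) : Integrable g m :=
  Integrable.of_bound hg.aestronglyMeasurable C (Eventually.of_forall hC)

/-- After expanding the square, the off-diagonal terms vanish by conditional independence and
centring. On the diagonal, a variance under `P x` is at most the second moment. -/
theorem IsBMC.integral_sq_sum_bounded_le (hX : IsBMC ρ ν P X) {g : S × S × S → ℝ}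
    (hg : Measurable g) {C : ℝ} (hC : ∀ t, |g t| ≤ C) (k : ℕ) :
    ∫ ω, (∑ u ∈ gen k, (g (triangle X u ω) - actTriple P g (X u ω))) ^ 2 ∂ρ
      ≤ ∑ u ∈ gen k, ∫ ω, actTriple P (fun t => g t ^ 2) (X u ω) ∂ρ := by
  set G : S × S × S → ℝ := fun t => g t - actTriple P g t.1 with hGdef
  have hT := measurable_triangle hX.measurable
  have hG : Measurable G := hg.sub ((measurable_actTriple P hg).comp measurable_fst)
  have hGC : ∀ t, |G t| ≤ C + C := fun t =>
    (abs_sub _ _).trans (add_le_add (hC t) (abs_actTriple_le P hC _))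
  have hint : ∀ x, Integrable (fun p => g (x, p)) (P x) := fun x =>
    integrable_of_abs_le (hg.comp measurable_prodMk_left) fun p => hC (x, p)
  have hG2 : Measurable fun t => G t ^ 2 := hG.pow_const 2
  have hG2C : ∀ t, |G t ^ 2| ≤ (C + C) ^ 2 := fun t => by
    rw [abs_pow]; exact pow_le_pow_left₀ (abs_nonneg _) (hGC t) 2
  have hg2 : Measurable fun t => g t ^ 2 := hg.pow_const 2
  have hg2C : ∀ t, |g t ^ 2| ≤ C ^ 2 := fun t => by
    rw [abs_pow]; exact pow_le_pow_left₀ (abs_nonneg _) (hC t) 2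
  have hint2 : ∀ x, Integrable (fun p => g (x, p) ^ 2) (P x) := fun x =>
    integrable_of_abs_le (hg2.comp measurable_prodMk_left) fun p => hg2C (x, p)
  have hPG : ∀ x, actTriple P G x = 0 := fun x => by
    simp only [actTriple, hGdef]
    rw [integral_sub (hint x) (integrable_const _)]
    simp
  have hPG2 : ∀ x, actTriple P (fun t => G t ^ 2) x ≤ actTriple P (fun t => g t ^ 2) x := fun x => by
    have : ∀ p, G (x, p) ^ 2 = g (x, p) ^ 2 - 2 * actTriple P g x * g (x, p)
        + actTriple P g x ^ 2 := fun p => by simp only [hGdef]; ring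
    have h1 : Integrable (fun p => 2 * actTriple P g x * g (x, p)) (P x) := (hint x).const_mul _
    have h2 : Integrable (fun p => g (x, p) ^ 2 - 2 * actTriple P g x * g (x, p)) (P x) :=
      (hint2 x).sub h1
    have h3 : ∫ p, g (x, p) ∂(P x) = actTriple P g x := rfl
    have h4 : ∫ p, g (x, p) ^ 2 ∂(P x) = actTriple P (fun t => g t ^ 2) x := rfl
    calc actTriple P (fun t => G t ^ 2) x
        = ∫ p, (g (x, p) ^ 2 - 2 * actTriple P g x * g (x, p) + actTriple P g x ^ 2) ∂(P x) :=
          integral_congr_ae (Eventually.of_forall this)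
      _ = actTriple P (fun t => g t ^ 2) x - actTriple P g x ^ 2 := by
          rw [integral_add h2 (integrable_const _), integral_sub (hint2 x) h1, integral_const_mul,
            h3, h4, integral_const, probReal_univ, one_smul]
          ring
      _ ≤ _ := sub_le_self _ (sq_nonneg _)
  have hmulint : ∀ u v, Integrable (fun ω => G (triangle X u ω) * G (triangle X v ω)) ρ :=
    fun u v => integrable_of_abs_le ((hG.comp (hT u)).mul (hG.comp (hT v)))
      (C := (C + C) * (C + C)) fun ω => by
        rw [abs_mul]
        exact mul_le_mul (hGC _) (hGC _) (abs_nonneg _) ((abs_nonneg _).trans (hGC (triangle X u ω)))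
  have e : ∀ ω, (∑ u ∈ gen k, (g (triangle X u ω) - actTriple P g (X u ω))) ^ 2
      = ∑ u ∈ gen k, ∑ v ∈ gen k, G (triangle X u ω) * G (triangle X v ω) := fun ω => by
    rw [sq, Finset.sum_mul_sum]
    rfl
  simp_rw [e]
  rw [integral_finsetSum _ fun u _ => integrable_finsetSum _ fun v _ => hmulint u v]
  refine Finset.sum_le_sum fun u hu => ?_
  rw [integral_finsetSum _ fun v _ => hmulint u v, Finset.sum_eq_single u]
  · have h1 := hX.setIntegral_triangle u (hG2.stronglyMeasurable)
      (integrable_of_abs_le (hG2.comp (hT u)) fun ω => hG2C _) (A := Set.univ) MeasurableSet.univ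
    simp only [Measure.restrict_univ] at h1
    simp_rw [← sq]
    rw [h1]
    refine integral_mono ?_ ?_ fun ω => hPG2 (X u ω)
    · exact integrable_of_abs_le ((measurable_actTriple P hG2).comp (hX.measurable u))
        fun ω => abs_actTriple_le P hG2C _
    · exact integrable_of_abs_le ((measurable_actTriple P hg2).comp (hX.measurable u))
        fun ω => abs_actTriple_le P hg2C _
  · intro v hv hvu
    rw [hX.integral_mul_triangle hG hGC hvu.symm ((mem_gen.1 hu).trans (mem_gen.1 hv).symm)]
    simp [hPG]
  · exact fun h => absurd hu h

/-- The conditional variance bound for the sum over the triangles of a generation. -/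
theorem IsBMC.lintegral_sq_sum_le (hX : IsBMC ρ ν P X) {f : S × S × S → ℝ}
    (hf : Measurable f) (hi : ∀ x, Integrable (fun p => f (x, p)) (P x))
    (hi2 : ∀ x, Integrable (fun p => f (x, p) ^ 2) (P x)) (k : ℕ) :
    ∫⁻ ω, ‖∑ u ∈ gen k, (f (triangle X u ω) - actTriple P f (X u ω))‖ₑ ^ 2 ∂ρ
      ≤ ∑ u ∈ gen k, ∫⁻ ω, ENNReal.ofReal (actTriple P (fun t => f t ^ 2) (X u ω)) ∂ρ := by
  have hT := measurable_triangle hX.measurable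
  -- Truncation reduces to bounded functions. Since `|F N| ≤ |f|`, the variance bound is uniform in
  -- `N`, and Fatou's lemma removes the truncation.
  set F : ℕ → S × S × S → ℝ := fun N => {t | |f t| ≤ N}.indicator f with hF
  have hFm : ∀ N, Measurable (F N) := fun N =>
    hf.indicator (measurableSet_le hf.abs measurable_const)
  have hFN : ∀ N t, |F N t| ≤ N := fun N t => by
    by_cases h : |f t| ≤ N
    · simp [hF, h]
    · simp [hF, h]
  have hFf : ∀ N t, |F N t| ≤ |f t| := fun N t => by
    by_cases h : |f t| ≤ N
    · simp [hF, h]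
    · simp [hF, h]
  have hFt : ∀ t, Tendsto (fun N => F N t) atTop (𝓝 (f t)) := fun t => by
    refine tendsto_const_nhds.congr' ?_
    obtain ⟨N, hN⟩ := exists_nat_ge |f t|
    filter_upwards [eventually_ge_atTop N] with M hM
    have : |f t| ≤ M := hN.trans (by exact_mod_cast hM)
    simp [hF, this]
  have hPt : ∀ x, Tendsto (fun N => actTriple P (F N) x) atTop (𝓝 (actTriple P f x)) := fun x =>
    tendsto_integral_of_dominated_convergence (fun p => |f (x, p)|)
      (fun N => ((hFm N).comp measurable_prodMk_left).aestronglyMeasurable) (hi x).abs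
      (fun N => Eventually.of_forall fun p => hFf N (x, p))
      (Eventually.of_forall fun p => hFt (x, p))
  have hmeas : ∀ N, Measurable fun ω =>
      ∑ u ∈ gen k, (F N (triangle X u ω) - actTriple P (F N) (X u ω)) := fun N =>
    Finset.measurable_fun_sum _ fun u _ => ((hFm N).comp (hT u)).sub
      ((measurable_actTriple P (hFm N)).comp (hX.measurable u))
  have hb : ∀ N, ∫⁻ ω, ‖∑ u ∈ gen k, (F N (triangle X u ω) - actTriple P (F N) (X u ω))‖ₑ ^ 2 ∂ρ
      ≤ ∑ u ∈ gen k, ∫⁻ ω, ENNReal.ofReal (actTriple P (fun t => f t ^ 2) (X u ω)) ∂ρ := by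
    intro N
    have hF2 : Measurable fun t => F N t ^ 2 := (hFm N).pow_const 2
    have hF2N : ∀ t, |F N t ^ 2| ≤ (N : ℝ) ^ 2 := fun t => by
      rw [abs_pow]; exact pow_le_pow_left₀ (abs_nonneg _) (hFN N t) 2
    have e : ∀ ω, ‖∑ u ∈ gen k, (F N (triangle X u ω) - actTriple P (F N) (X u ω))‖ₑ ^ 2
        = ENNReal.ofReal
          ((∑ u ∈ gen k, (F N (triangle X u ω) - actTriple P (F N) (X u ω))) ^ 2) := fun ω => by
      rw [← sq_abs, ENNReal.ofReal_pow (abs_nonneg _), ← Real.norm_eq_abs, ofReal_norm]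
    simp_rw [e]
    rw [← ofReal_integral_eq_lintegral_ofReal _ (Eventually.of_forall fun ω => sq_nonneg _)]
    · refine (ENNReal.ofReal_le_ofReal (hX.integral_sq_sum_bounded_le (hFm N) (hFN N) k)).trans ?_
      have hn : ∀ x, 0 ≤ actTriple P (fun t => F N t ^ 2) x := fun x =>
        integral_nonneg fun p => sq_nonneg _
      rw [ENNReal.ofReal_sum_of_nonneg fun u _ => integral_nonneg fun ω => hn _]
      refine Finset.sum_le_sum fun u _ => ?_
      rw [ofReal_integral_eq_lintegral_ofReal _ (Eventually.of_forall fun ω => hn _)]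
      · refine lintegral_mono fun ω => ENNReal.ofReal_le_ofReal ?_
        refine integral_mono (integrable_of_abs_le (hF2.comp measurable_prodMk_left)
          fun p => hF2N _) (hi2 _) fun p => ?_
        exact sq_le_sq.2 (hFf N _)
      · exact integrable_of_abs_le ((measurable_actTriple P hF2).comp (hX.measurable u))
          fun ω => abs_actTriple_le P hF2N _
    · refine integrable_of_abs_le ((hmeas N).pow_const 2)
        (C := (∑ u ∈ gen k, ((N : ℝ) + N)) ^ 2) fun ω => ?_
      rw [abs_pow]
      refine pow_le_pow_left₀ (abs_nonneg _) ((Finset.abs_sum_le_sum_abs _ _).trans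
        (Finset.sum_le_sum fun u _ => (abs_sub _ _).trans
          (add_le_add (hFN N _) (abs_actTriple_le P (hFN N) _)))) 2
  have hlim : ∀ ω, Tendsto (fun N =>
      ‖∑ u ∈ gen k, (F N (triangle X u ω) - actTriple P (F N) (X u ω))‖ₑ ^ 2) atTop
      (𝓝 (‖∑ u ∈ gen k, (f (triangle X u ω) - actTriple P f (X u ω))‖ₑ ^ 2)) := fun ω =>
    ((ENNReal.continuous_pow 2).tendsto _).comp
      ((continuous_enorm.tendsto _).comp
        (tendsto_finsetSum _ fun u _ => (hFt _).sub (hPt _)))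
  calc _ = ∫⁻ ω, liminf (fun N =>
        ‖∑ u ∈ gen k, (F N (triangle X u ω) - actTriple P (F N) (X u ω))‖ₑ ^ 2) atTop ∂ρ :=
        lintegral_congr fun ω => (hlim ω).liminf_eq.symm
    _ ≤ liminf (fun N => ∫⁻ ω,
        ‖∑ u ∈ gen k, (F N (triangle X u ω) - actTriple P (F N) (X u ω))‖ₑ ^ 2 ∂ρ) atTop :=
        lintegral_liminf_le fun N => (hmeas N).enorm.pow_const 2
    _ ≤ _ := by
        refine (liminf_le_liminf (Eventually.of_forall hb)).trans ?_
        simp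

end

/-! ### Isolating one frequency by averaging -/

section Cesaro

variable {J : Type*} [Fintype J]

/-- Multiply by `θ i ^ (-n)` and average over `n < N`: the `i`-th term stays `c i`, while each other
term is a geometric sum of ratio `θ j / θ i ≠ 1`, bounded in `N`, hence negligible after division by
`N`. -/
theorem norm_coeff_le_of_norm_sum_le {θ c : J → ℂ} (hθ : Function.Injective θ)
    (h1 : ∀ j, ‖θ j‖ = 1) {B : ℝ} (hB : ∀ n : ℕ, ‖∑ j, θ j ^ n * c j‖ ≤ B) (i : J) :
    ‖c i‖ ≤ B := by
  classical
  have h0 : ∀ j, θ j ≠ 0 := fun j hj => by simpa [hj] using h1 j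
  -- A geometric sum of unimodular ratio `z ≠ 1` has modulus at most `2 / ‖z - 1‖`, whatever its
  -- length.
  set K : ℝ := ∑ j ∈ Finset.univ.erase i, ‖c j‖ * (2 / ‖θ j / θ i - 1‖) with hK
  have key : ∀ N : ℕ, (N : ℝ) * ‖c i‖ ≤ N * B + K := fun N => by
    have e : (N : ℂ) * c i = ∑ n ∈ Finset.range N, (θ i)⁻¹ ^ n * ∑ j, θ j ^ n * c j
        - ∑ j ∈ Finset.univ.erase i, c j * ∑ n ∈ Finset.range N, (θ j / θ i) ^ n := by
      simp_rw [Finset.mul_sum]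
      rw [Finset.sum_comm, ← Finset.add_sum_erase _ _ (Finset.mem_univ i)]
      have h2 : ∑ n ∈ Finset.range N, (θ i)⁻¹ ^ n * (θ i ^ n * c i) = N * c i := by
        rw [Finset.sum_congr rfl fun n _ => show _ = c i by
          rw [← mul_assoc, ← mul_pow, inv_mul_cancel₀ (h0 i), one_pow, one_mul]]
        simp
      rw [h2, add_sub_assoc, ← Finset.sum_sub_distrib, Finset.sum_eq_zero, add_zero]
      intro j _
      rw [← Finset.sum_sub_distrib]
      refine Finset.sum_eq_zero fun n _ => ?_
      rw [div_pow, inv_pow]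
      ring
    have hn : (N : ℝ) * ‖c i‖ = ‖(N : ℂ) * c i‖ := by simp
    rw [hn, e]
    refine (norm_sub_le _ _).trans (add_le_add ?_ ?_)
    · calc _ ≤ ∑ n ∈ Finset.range N, B := by
            refine (norm_sum_le _ _).trans (Finset.sum_le_sum fun n _ => ?_)
            rw [norm_mul, norm_pow, norm_inv, h1, inv_one, one_pow, one_mul]
            exact hB n
        _ = _ := by simp
    · refine (norm_sum_le _ _).trans (Finset.sum_le_sum fun j hj => ?_)
      rw [norm_mul]
      refine mul_le_mul_of_nonneg_left ?_ (norm_nonneg _)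
      have hne : θ j / θ i ≠ 1 := fun h => (Finset.ne_of_mem_erase hj)
        (hθ ((div_eq_one_iff_eq (h0 i)).1 h))
      rw [geom_sum_eq hne, norm_div]
      refine div_le_div_of_nonneg_right ((norm_sub_le _ _).trans ?_) (norm_nonneg _)
      rw [norm_pow, norm_div, h1, h1, div_one, one_pow, norm_one]
      norm_num
  by_contra! hlt
  obtain ⟨N, hN⟩ := exists_nat_gt (K / (‖c i‖ - B))
  rw [div_lt_iff₀ (sub_pos.2 hlt)] at hN
  linarith [key N]

end Cesaro

/-! ### The operator `Q` -/

section

variable {S : Type*} [MeasurableSpace S] {P : Kernel S (S × S)}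

theorem integrable_inducedKernel {E : Type*} [NormedAddCommGroup E] {f : S → E}
    (hf : StronglyMeasurable f) {x : S} (h1 : Integrable (fun p : S × S => f p.1) (P x))
    (h2 : Integrable (fun p : S × S => f p.2) (P x)) : Integrable f (inducedKernel P x) := by
  change Integrable f ((2⁻¹ : ℝ≥0∞) • (P.fst x + P.snd x))
  refine Integrable.smul_measure (Integrable.add_measure ?_ ?_) (by simp)
  · rw [Kernel.fst_apply]
    exact (integrable_map_measure hf.aestronglyMeasurable measurable_fst.aemeasurable).2 h1
  · rw [Kernel.snd_apply]
    exact (integrable_map_measure hf.aestronglyMeasurable measurable_snd.aemeasurable).2 h2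

theorem actQ_eq {E : Type*} [NormedAddCommGroup E] [NormedSpace ℝ E] {f : S → E}
    (hf : StronglyMeasurable f) {x : S} (h1 : Integrable (fun p : S × S => f p.1) (P x))
    (h2 : Integrable (fun p : S × S => f p.2) (P x)) :
    actQ P f x = (2⁻¹ : ℝ) • ∫ p, (f p.1 + f p.2) ∂(P x) := by
  have h1' : Integrable f ((P x).map Prod.fst) :=
    (integrable_map_measure hf.aestronglyMeasurable measurable_fst.aemeasurable).2 h1
  have h2' : Integrable f ((P x).map Prod.snd) :=
    (integrable_map_measure hf.aestronglyMeasurable measurable_snd.aemeasurable).2 h2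
  change ∫ y, f y ∂((2⁻¹ : ℝ≥0∞) • (P.fst x + P.snd x)) = _
  rw [integral_smul_measure, Kernel.fst_apply, Kernel.snd_apply, integral_add_measure h1' h2',
    integral_map measurable_fst.aemeasurable hf.aestronglyMeasurable,
    integral_map measurable_snd.aemeasurable hf.aestronglyMeasurable, integral_add h1 h2]
  simp

theorem actQ_toComplex (f : S → ℝ) : actQ P (toComplex f) = toComplex (actQ P f) :=
  funext fun _ => integral_ofReal

theorem iterate_actQ_toComplex (f : S → ℝ) (n : ℕ) :
    (actQ P)^[n] (toComplex f) = toComplex ((actQ P)^[n] f) := by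
  induction n with
  | zero => rfl
  | succ n ih => rw [Function.iterate_succ_apply', ih, actQ_toComplex,
      Function.iterate_succ_apply']

end

/-! ### The complex span of the test space -/

section

variable {S : Type*} {F : Submodule ℝ (S → ℝ)}

/-- This is `ℂF = F + iF`; through it measurability, integrability and stability under `Q` pass from
`F` to `ℂF`. -/
theorem mem_complexSpan_iff {h : S → ℂ} :
    h ∈ complexSpan F ↔ (fun x => (h x).re) ∈ F ∧ (fun x => (h x).im) ∈ F := by
  constructor
  · intro hh
    refine Submodule.span_induction (p := fun h _ => (fun x => (h x).re) ∈ F ∧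
      (fun x => (h x).im) ∈ F) ?_ ?_ ?_ ?_ hh
    · rintro _ ⟨f, hf, rfl⟩
      exact ⟨hf, F.zero_mem⟩
    · exact ⟨F.zero_mem, F.zero_mem⟩
    · rintro f g - - ⟨hf1, hf2⟩ ⟨hg1, hg2⟩
      exact ⟨F.add_mem hf1 hg1, F.add_mem hf2 hg2⟩
    · rintro c f - ⟨hf1, hf2⟩
      refine ⟨?_, ?_⟩
      · convert F.sub_mem (F.smul_mem c.re hf1) (F.smul_mem c.im hf2) using 1
        ext x
        simp
      · convert F.add_mem (F.smul_mem c.re hf2) (F.smul_mem c.im hf1) using 1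
        ext x
        simp
  · rintro ⟨h1, h2⟩
    have e : h = toComplex (fun x => (h x).re) + Complex.I • toComplex (fun x => (h x).im) := by
      ext x
      simp only [toComplex, Pi.add_apply, Pi.smul_apply, smul_eq_mul]
      rw [mul_comm, Complex.re_add_im]
    rw [e]
    exact Submodule.add_mem _ (Submodule.subset_span ⟨_, h1, rfl⟩)
      (Submodule.smul_mem _ _ (Submodule.subset_span ⟨_, h2, rfl⟩))

theorem re_mem (h : complexSpan F) : (fun x => ((h : S → ℂ) x).re) ∈ F :=
  (mem_complexSpan_iff.1 h.2).1

theorem im_mem (h : complexSpan F) : (fun x => ((h : S → ℂ) x).im) ∈ F :=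
  (mem_complexSpan_iff.1 h.2).2

theorem integrable_complex_of {α : Type*} [MeasurableSpace α] {m : Measure α} {T : α → S}
    (hT : ∀ f ∈ F, Integrable (fun t => f (T t)) m) (h : complexSpan F) :
    Integrable (fun t => (h : S → ℂ) (T t)) m := by
  have e : (fun t => (h : S → ℂ) (T t))
      = fun t => (((h : S → ℂ) (T t)).re : ℂ) + ((h : S → ℂ) (T t)).im * Complex.I :=
    funext fun t => (Complex.re_add_im _).symm
  rw [e]
  exact (hT _ (re_mem h)).ofReal.add ((hT _ (im_mem h)).ofReal.mul_const _)

end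

/-! ### `Q` as an endomorphism of `ℂF` -/

section

variable {S : Type*} [MeasurableSpace S] {ν : Measure S} {P : Kernel S (S × S)}
  {F : Submodule ℝ (S → ℝ)}

namespace IsTestSpace

variable (hF : IsTestSpace ν P F)

include hF

theorem integrable_fst {f : S → ℝ} (hf : f ∈ F) (x : S) :
    Integrable (fun p : S × S => f p.1) (P x) := by
  simpa using hF.integrable_tensor f hf _ (hF.const_mem 1) x

theorem integrable_snd {f : S → ℝ} (hf : f ∈ F) (x : S) :
    Integrable (fun p : S × S => f p.2) (P x) := by
  simpa using hF.integrable_tensor _ (hF.const_mem 1) f hf x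

theorem integrable_induced {f : S → ℝ} (hf : f ∈ F) (x : S) : Integrable f (inducedKernel P x) :=
  integrable_inducedKernel (hF.measurable f hf).stronglyMeasurable (hF.integrable_fst hf x)
    (hF.integrable_snd hf x)

theorem actQ_eq {f : S → ℝ} (hf : f ∈ F) (x : S) :
    actQ P f x = 2⁻¹ * ∫ p, (f p.1 + f p.2) ∂(P x) :=
  BMC.actQ_eq (hF.measurable f hf).stronglyMeasurable (hF.integrable_fst hf x)
    (hF.integrable_snd hf x)

/-- `Q f` is half of `P (f ⊗ 1) + P (1 ⊗ f)`, and `F` contains the constants. -/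
theorem actQ_mem {f : S → ℝ} (hf : f ∈ F) : actQ P f ∈ F := by
  convert F.smul_mem 2⁻¹ (F.add_mem (hF.tensor_mem f hf _ (hF.const_mem 1))
    (hF.tensor_mem _ (hF.const_mem 1) f hf)) using 1
  ext x
  rw [hF.actQ_eq hf, integral_add (hF.integrable_fst hf x) (hF.integrable_snd hf x)]
  simp [actPair]

theorem iterate_actQ_mem {f : S → ℝ} (hf : f ∈ F) (n : ℕ) : (actQ P)^[n] f ∈ F := by
  induction n with
  | zero => exact hf
  | succ n ih => rw [Function.iterate_succ_apply']; exact hF.actQ_mem ih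

theorem measurable_complex (h : complexSpan F) : Measurable (h : S → ℂ) := by
  have e : (h : S → ℂ) = fun x => (((h : S → ℂ) x).re : ℂ) + ((h : S → ℂ) x).im * Complex.I :=
    funext fun x => (Complex.re_add_im _).symm
  rw [e]
  exact (Complex.measurable_ofReal.comp (hF.measurable _ (re_mem h))).add
    ((Complex.measurable_ofReal.comp (hF.measurable _ (im_mem h))).mul_const _)

theorem integrable_induced_complex (h : complexSpan F) (x : S) :
    Integrable (h : S → ℂ) (inducedKernel P x) :=
  integrable_complex_of (T := id) (fun _ hf => hF.integrable_induced hf x) h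

theorem re_actQ (h : complexSpan F) (x : S) :
    (actQ P (h : S → ℂ) x).re = actQ P (fun y => ((h : S → ℂ) y).re) x :=
  (Complex.reCLM.integral_comp_comm (hF.integrable_induced_complex h x)).symm

theorem im_actQ (h : complexSpan F) (x : S) :
    (actQ P (h : S → ℂ) x).im = actQ P (fun y => ((h : S → ℂ) y).im) x :=
  (Complex.imCLM.integral_comp_comm (hF.integrable_induced_complex h x)).symm

theorem actQ_mem_complexSpan (h : complexSpan F) : actQ P (h : S → ℂ) ∈ complexSpan F := by
  rw [mem_complexSpan_iff]
  simp only [hF.re_actQ, hF.im_actQ]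
  exact ⟨hF.actQ_mem (re_mem h), hF.actQ_mem (im_mem h)⟩

/-- The operator `Q` on `ℂF`. -/
noncomputable def qEnd : Module.End ℂ (complexSpan F) where
  toFun h := ⟨actQ P (h : S → ℂ), hF.actQ_mem_complexSpan h⟩
  map_add' f g := Subtype.ext <| funext fun x =>
    integral_add (hF.integrable_induced_complex f x) (hF.integrable_induced_complex g x)
  map_smul' c f := Subtype.ext <| funext fun _ => integral_smul c (f : S → ℂ)

theorem coe_qEnd (h : complexSpan F) : (hF.qEnd h : S → ℂ) = actQ P (h : S → ℂ) := rfl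

theorem coe_qEnd_pow (n : ℕ) (h : complexSpan F) :
    ((hF.qEnd ^ n) h : S → ℂ) = (actQ P)^[n] (h : S → ℂ) := by
  induction n with
  | zero => rfl
  | succ n ih =>
    rw [pow_succ', Module.End.mul_apply, coe_qEnd, ih, Function.iterate_succ_apply']

theorem actQ_mono {f g : S → ℝ} (hf : f ∈ F) (hg : g ∈ F) (hfg : ∀ x, f x ≤ g x) (x : S) :
    actQ P f x ≤ actQ P g x :=
  integral_mono (hF.integrable_induced hf x) (hF.integrable_induced hg x) hfg

theorem norm_actQ_le (h : S → ℂ) {g : S → ℝ} (hg : g ∈ F) {c : ℝ}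
    (hgh : ∀ y, ‖h y‖ ≤ c * g y) (x : S) : ‖actQ P h x‖ ≤ c * actQ P g x := by
  refine (norm_integral_le_of_norm_le ((hF.integrable_induced hg x).const_mul c)
    (Eventually.of_forall hgh)).trans_eq ?_
  rw [integral_const_mul]
  rfl

/-- `F` is not assumed stable under absolute values, but `t ≤ 1 + t ^ 2` needs only constants and
squares. -/
theorem exists_norm_le (h : complexSpan F) : ∃ g ∈ F, ∀ x, ‖(h : S → ℂ) x‖ ≤ g x := by
  refine ⟨_, F.add_mem (F.add_mem (hF.const_mem 1) (hF.sq_mem _ (re_mem h)))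
    (hF.sq_mem _ (im_mem h)), fun x => ?_⟩
  have h1 : ‖(h : S → ℂ) x‖ ^ 2 = ((h : S → ℂ) x).re ^ 2 + ((h : S → ℂ) x).im ^ 2 := by
    rw [Complex.sq_norm, Complex.normSq_apply]
    ring
  simp only [Pi.add_apply]
  nlinarith [sq_nonneg (‖(h : S → ℂ) x‖ - 1), norm_nonneg ((h : S → ℂ) x)]

end IsTestSpace

section Markov

variable [IsMarkovKernel P]

theorem actQ_const (c : ℝ) : actQ P (fun _ : S => c) = fun _ => c := by
  ext x
  rw [BMC.actQ_eq stronglyMeasurable_const (integrable_const _) (integrable_const _)]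
  simp
  ring

theorem qEnd_one (hF : IsTestSpace ν P F) :
    hF.qEnd (inSpan ⟨_, hF.const_mem 1⟩) = inSpan ⟨_, hF.const_mem 1⟩ :=
  Subtype.ext <| by
    rw [hF.coe_qEnd]
    simp only [inSpan]
    rw [actQ_toComplex, actQ_const]

end Markov

/-! ### Consequences of the spectral gap -/

section Gap

variable {J : Type*} [Fintype J] {μ : Measure S} {α : ℝ} {a : J → ℂ}
  {R : J → Module.End ℂ (complexSpan F)} {β : ℕ → ℝ}

namespace SecondSpectralGap

variable (hgap : SecondSpectralGap P F μ α a R β)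

include hgap

theorem pow_mul_theta_pow (n : ℕ) (j : J) : (α : ℂ) ^ n * theta α a j ^ n = a j ^ n := by
  have : (α : ℂ) ≠ 0 := by exact_mod_cast hgap.rate_pos.ne'
  rw [theta, div_pow, mul_div_cancel₀ _ (pow_ne_zero _ this)]

theorem norm_theta (j : J) : ‖theta α a j‖ = 1 := by
  rw [theta, norm_div, hgap.norm_eq, Complex.norm_real, Real.norm_of_nonneg hgap.rate_pos.le,
    div_self hgap.rate_pos.ne']

theorem theta_injective : Function.Injective (theta α a) := fun i j hij => by
  have : (α : ℂ) ≠ 0 := by exact_mod_cast hgap.rate_pos.ne'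
  exact hgap.injective ((div_left_inj' this).1 hij)

theorem gap_qEnd (hF : IsTestSpace ν P F) (f : F) : ∃ g ∈ F, ∀ (n : ℕ) (x : S),
    ‖(((hF.qEnd ^ n) (inSpan f) - ((∫ y, (f : S → ℝ) y ∂μ : ℝ) : ℂ) •
      inSpan ⟨_, hF.const_mem 1⟩ - ∑ j, a j ^ n • R j (inSpan f) : complexSpan F) : S → ℂ) x‖
      ≤ β n * α ^ n * g x := by
  obtain ⟨g, hg, h⟩ := hgap.gap f
  refine ⟨g, hg, fun n x => ?_⟩
  convert h n x using 2
  simp only [Submodule.coe_sub, Pi.sub_apply, hF.coe_qEnd_pow, Submodule.coe_smul, Pi.smul_apply,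
    Submodule.coe_sum, Finset.sum_apply, smul_eq_mul, Finset.mul_sum, ← mul_assoc,
    hgap.pow_mul_theta_pow]
  simp [inSpan, iterate_actQ_toComplex, toComplex, proj]

/-- The iterates of `Q` on a function of `F` are dominated by an integrable function. -/
theorem exists_abs_iterate_le (hF : IsTestSpace ν P F) {f : S → ℝ} (hf : f ∈ F) :
    ∃ G : S → ℝ, Integrable G ν ∧ ∀ n x, |(actQ P)^[n] f x| ≤ G x := by
  obtain ⟨g, hg, h⟩ := hgap.gap ⟨f, hf⟩
  choose r hr hr' using fun j => hF.exists_norm_le (R j (inSpan ⟨f, hf⟩))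
  refine ⟨(fun _ => |∫ y, f y ∂μ|) + ∑ j, r j + g, hF.integrable_initial _
    (F.add_mem (F.add_mem (hF.const_mem _) (F.sum_mem fun j _ => hr j)) hg), fun n x => ?_⟩
  -- The gap at `n = 0` bounds a norm by `β 0 * g x`, and `β 0 > 0`.
  have hg0 : 0 ≤ g x := by
    have := (norm_nonneg _).trans (h 0 x)
    simp only [pow_zero, mul_one] at this
    exact nonneg_of_mul_nonneg_right this (hgap.beta_pos 0)
  have hα : α ^ n ≤ 1 := pow_le_one₀ hgap.rate_pos.le hgap.rate_lt_one.le
  have h1 := h n x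
  have h2 : ‖(α : ℂ) ^ n * ∑ j, theta α a j ^ n * proj R j ⟨f, hf⟩ x‖ ≤ ∑ j, r j x := by
    rw [norm_mul, norm_pow, Complex.norm_real, Real.norm_of_nonneg hgap.rate_pos.le]
    refine (mul_le_of_le_one_left (norm_nonneg _) hα).trans ((norm_sum_le _ _).trans ?_)
    refine Finset.sum_le_sum fun j _ => ?_
    rw [norm_mul, norm_pow, hgap.norm_theta, one_pow, one_mul]
    exact hr' j x
  have h3 : β n * α ^ n * g x ≤ g x := mul_le_of_le_one_left hg0
    (mul_le_one₀ (hgap.beta_le_one n) (pow_nonneg hgap.rate_pos.le _) hα)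
  set q := (actQ P)^[n] f x
  set s := (α : ℂ) ^ n * ∑ j, theta α a j ^ n * proj R j ⟨f, hf⟩ x
  set m := ∫ y, f y ∂μ
  have h4 : (q : ℂ) = m + s + ((q : ℂ) - m - s) := by ring
  have h5 : |q| ≤ ‖(m : ℂ)‖ + ‖s‖ + ‖(q : ℂ) - m - s‖ := by
    rw [← Real.norm_eq_abs, ← Complex.norm_real]
    conv_lhs => rw [h4]
    exact norm_add₃_le
  rw [Complex.norm_real, Real.norm_eq_abs] at h5
  simp only [Pi.add_apply, Finset.sum_apply]
  linarith

variable [IsMarkovKernel P]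

/-- Let `H n` be the remainder of the gap. Since `Q 1 = 1`, the difference `Q (H n) - H (n + 1)` is
`-∑ j, a j ^ n (Q R_j f - a j R_j f)`, and it is `O(β n α ^ n)` pointwise. Dividing by `α ^ n`
leaves distinct unimodular frequencies, so each coefficient is zero because `β n → 0`. -/
theorem qEnd_proj (hF : IsTestSpace ν P F) (j : J) (f : F) :
    hF.qEnd (R j (inSpan f)) = a j • R j (inSpan f) := by
  obtain ⟨g, hg, h⟩ := hgap.gap_qEnd hF f
  refine Subtype.ext <| funext fun x => ?_
  set m : ℂ := ((∫ y, (f : S → ℝ) y ∂μ : ℝ) : ℂ)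
  set e : complexSpan F := inSpan ⟨_, hF.const_mem 1⟩
  set H : ℕ → complexSpan F := fun n =>
    (hF.qEnd ^ n) (inSpan f) - m • e - ∑ j, a j ^ n • R j (inSpan f) with hH
  set c : J → ℂ := fun j =>
    ((hF.qEnd (R j (inSpan f)) - a j • R j (inSpan f) : complexSpan F) : S → ℂ) x with hc
  have hg0 : ∀ y, 0 ≤ g y := fun y => by
    have := (norm_nonneg _).trans (h 0 y)
    simp only [pow_zero, mul_one] at this
    exact nonneg_of_mul_nonneg_right this (hgap.beta_pos 0)
  set K : ℝ := actQ P g x + g x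
  have hQg : 0 ≤ actQ P g x := integral_nonneg hg0
  have hK : 0 ≤ K := add_nonneg hQg (hg0 x)
  have hdiff : ∀ n, hF.qEnd (H n) - H (n + 1)
      = - ∑ j, a j ^ n • (hF.qEnd (R j (inSpan f)) - a j • R j (inSpan f)) := fun n => by
    simp only [hH, map_sub, map_smul, map_sum, e, qEnd_one, ← Module.End.mul_apply, ← pow_succ',
      smul_sub, Finset.sum_sub_distrib, smul_smul, ← pow_succ]
    abel
  have hb : ∀ n, ‖∑ j, theta α a j ^ n * c j‖ ≤ β n * K := fun n => by
    have h1 : ‖((hF.qEnd (H n) - H (n + 1) : complexSpan F) : S → ℂ) x‖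
        ≤ β n * α ^ n * K := by
      rw [Submodule.coe_sub, Pi.sub_apply, hF.coe_qEnd, mul_add]
      refine (norm_sub_le _ _).trans (add_le_add (hF.norm_actQ_le _ hg (h n) x)
        ((h (n + 1) x).trans (mul_le_mul_of_nonneg_right ?_ (hg0 x))))
      exact mul_le_mul (hgap.beta_anti n.le_succ)
        (pow_le_pow_of_le_one hgap.rate_pos.le hgap.rate_lt_one.le n.le_succ)
        (pow_nonneg hgap.rate_pos.le _) (hgap.beta_pos n).le
    rw [hdiff, Submodule.coe_neg, Pi.neg_apply, norm_neg] at h1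
    simp only [Submodule.coe_sum, Finset.sum_apply, Submodule.coe_smul, Pi.smul_apply,
      smul_eq_mul] at h1
    have h2 : ∑ j, a j ^ n * c j = (α : ℂ) ^ n * ∑ j, theta α a j ^ n * c j := by
      rw [Finset.mul_sum]
      exact Finset.sum_congr rfl fun j _ => by rw [← mul_assoc, hgap.pow_mul_theta_pow]
    change ‖∑ j, a j ^ n * c j‖ ≤ _ at h1
    rw [h2, norm_mul, norm_pow, Complex.norm_real, Real.norm_of_nonneg hgap.rate_pos.le,
      mul_comm (β n), mul_assoc] at h1
    exact le_of_mul_le_mul_left h1 (pow_pos hgap.rate_pos n)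
  -- Averaging from time `N` on replaces `c j` by `θ_j ^ N * c j`, of the same modulus, and improves
  -- the bound to `β N * K`.
  have hz : ∀ N, ‖c j‖ ≤ β N * K := fun N => by
    have h3 := norm_coeff_le_of_norm_sum_le (c := fun j => theta α a j ^ N * c j)
      hgap.theta_injective hgap.norm_theta (B := β N * K) (fun n => by
        simp only [← mul_assoc, ← pow_add]
        exact (hb (n + N)).trans
          (mul_le_mul_of_nonneg_right (hgap.beta_anti (Nat.le_add_left N n)) hK)) j
    simpa [hgap.norm_theta] using h3
  have hlim : Tendsto (fun N => β N * K) atTop (𝓝 0) := by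
    simpa using hgap.beta_tendsto.mul_const K
  have : c j = 0 := norm_le_zero_iff.1 (ge_of_tendsto' hlim hz)
  simpa [hc, sub_eq_zero] using this

theorem qEnd_pow_proj (hF : IsTestSpace ν P F) (j : J) (f : F) (n : ℕ) :
    (hF.qEnd ^ n) (R j (inSpan f)) = a j ^ n • R j (inSpan f) := by
  induction n with
  | zero => simp
  | succ n ih =>
    rw [pow_succ', Module.End.mul_apply, ih, map_smul, hgap.qEnd_proj, smul_smul, pow_succ]

/-- The iterates of `Q` on the centred and hat functions differ by `∑ j, a j ^ n R_j (h l)`, so `∑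
j, θ_j ^ n R_j (h l)` is at most `2 g` for every `n`, and averaging bounds each coefficient. This
makes the martingale estimates uniform in `l`. -/
theorem norm_proj_le_of_uniformGap (hF : IsTestSpace ν P F) {h : ℕ → F} {g : S → ℝ}
    (hg : ∀ (n l : ℕ) (x : S), |(actQ P)^[n] (centered μ (h l)) x| ≤ α ^ n * g x ∧
      ‖(actQ P)^[n] (hat μ R (h l)) x‖ ≤ β n * α ^ n * g x) (j : J) (l : ℕ) (x : S) :
    ‖proj R j (h l) x‖ ≤ 2 * g x := by
  have hcm : centered μ (h l) ∈ F := F.sub_mem (h l).2 (hF.const_mem _)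
  refine norm_coeff_le_of_norm_sum_le (c := fun j => proj R j (h l) x) hgap.theta_injective
    hgap.norm_theta (fun n => ?_) j
  have e : hat μ R (h l)
      = ((inSpan ⟨_, hcm⟩ - ∑ j, R j (inSpan (h l)) : complexSpan F) : S → ℂ) := by
    ext y
    simp [hat, proj, inSpan, toComplex]
  have e2 : (α : ℂ) ^ n * ∑ j, theta α a j ^ n * proj R j (h l) x
      = (((actQ P)^[n] (centered μ (h l)) x : ℝ) : ℂ) - (actQ P)^[n] (hat μ R (h l)) x := by
    rw [e, ← hF.coe_qEnd_pow, map_sub, map_sum]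
    simp only [hgap.qEnd_pow_proj, Submodule.coe_sub, Pi.sub_apply, hF.coe_qEnd_pow,
      Submodule.coe_sum, Finset.sum_apply, Submodule.coe_smul, Pi.smul_apply, smul_eq_mul,
      Finset.mul_sum, ← mul_assoc, hgap.pow_mul_theta_pow]
    simp [inSpan, iterate_actQ_toComplex, toComplex, proj]
  have hα := hgap.rate_pos
  have hg0 : 0 ≤ g x := by
    have := (abs_nonneg _).trans (hg 0 l x).1
    simpa using this
  have h1 : ‖(α : ℂ) ^ n * ∑ j, theta α a j ^ n * proj R j (h l) x‖ ≤ α ^ n * (2 * g x) := by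
    rw [e2]
    refine (norm_sub_le _ _).trans ?_
    rw [Complex.norm_real, Real.norm_eq_abs]
    have := mul_le_mul_of_nonneg_right (hgap.beta_le_one n)
      (mul_nonneg (pow_nonneg hα.le n) hg0)
    linarith [hg n l x]
  rw [norm_mul, norm_pow, Complex.norm_real, Real.norm_of_nonneg hα.le] at h1
  exact le_of_mul_le_mul_left h1 (pow_pos hα n)

end SecondSpectralGap

end Gap

end

/-! ### `L²` bounds for sums over a generation -/

section

variable {Ω : Type*} [MeasurableSpace Ω] {ρ : Measure Ω}

theorem eLpNorm_two_le {E : Type*} [NormedAddCommGroup E] {f : Ω → E} {D : ℝ} (hD : 0 ≤ D)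
    (h : ∫⁻ ω, ‖f ω‖ₑ ^ 2 ∂ρ ≤ ENNReal.ofReal (D ^ 2)) : eLpNorm f 2 ρ ≤ ENNReal.ofReal D := by
  rw [eLpNorm_eq_lintegral_rpow_enorm_toReal (by simp) (by simp)]
  simp only [ENNReal.toReal_ofNat, ENNReal.rpow_ofNat]
  refine (ENNReal.rpow_le_rpow h (by norm_num)).trans_eq ?_
  rw [ENNReal.ofReal_rpow_of_nonneg (sq_nonneg D) (by norm_num), ← Real.sqrt_eq_rpow,
    Real.sqrt_sq hD]

theorem enorm_sq_complex (z : ℂ) : ‖z‖ₑ ^ 2 = ‖z.re‖ₑ ^ 2 + ‖z.im‖ₑ ^ 2 := by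
  simp only [← ofReal_norm, ← ENNReal.ofReal_pow (norm_nonneg _)]
  rw [← ENNReal.ofReal_add (sq_nonneg _) (sq_nonneg _), Complex.sq_norm, Complex.normSq_apply]
  simp [sq]

end

section

variable {Ω S : Type*} {X : Tree → Ω → S}

/-- The sum of `h (X_u)` over the `n`-th generation. -/
noncomputable def genSum (X : Tree → Ω → S) (h : S → ℂ) (n : ℕ) (ω : Ω) : ℂ :=
  ∑ u ∈ gen n, h (X u ω)

theorem genSum_zero (h : S → ℂ) (ω : Ω) : genSum X h 0 ω = h (X [] ω) := by
  simp [genSum, gen_zero]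

theorem genSum_add (f g : S → ℂ) (n : ℕ) (ω : Ω) :
    genSum X (f + g) n ω = genSum X f n ω + genSum X g n ω := Finset.sum_add_distrib

theorem genSum_smul (c : ℂ) (f : S → ℂ) (n : ℕ) (ω : Ω) :
    genSum X (c • f) n ω = c * genSum X f n ω := (Finset.mul_sum _ _ _).symm

theorem genSum_sum {ι : Type*} (s : Finset ι) (f : ι → S → ℂ) (n : ℕ) (ω : Ω) :
    genSum X (∑ i ∈ s, f i) n ω = ∑ i ∈ s, genSum X (f i) n ω := by
  simp only [genSum, Finset.sum_apply]
  exact Finset.sum_comm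

end

section

variable {Ω : Type*} [MeasurableSpace Ω] {ρ : Measure Ω}
  {S : Type*} [MeasurableSpace S] {ν : Measure S} {P : Kernel S (S × S)}
  {X : Tree → Ω → S} {F : Submodule ℝ (S → ℝ)}

theorem measurable_genSum (hX : ∀ u, Measurable (X u)) (hF : IsTestSpace ν P F)
    (h : complexSpan F) (n : ℕ) : Measurable (genSum X (h : S → ℂ) n) :=
  Finset.measurable_fun_sum _ fun u _ => (hF.measurable_complex h).comp (hX u)

variable [IsProbabilityMeasure ρ] [IsMarkovKernel P]

namespace IsBMC

variable (hX : IsBMC ρ ν P X) (hF : IsTestSpace ν P F)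

include hX hF

theorem lintegral_daughters {φ : S → ℝ} (hφ : φ ∈ F) (h0 : ∀ x, 0 ≤ φ x) (u : Tree) :
    ∫⁻ ω, ENNReal.ofReal (φ (X (u ++ [false]) ω)) ∂ρ
      + ∫⁻ ω, ENNReal.ofReal (φ (X (u ++ [true]) ω)) ∂ρ
      = 2 * ∫⁻ ω, ENNReal.ofReal (actQ P φ (X u ω)) ∂ρ := by
  have hm := hF.measurable φ hφ
  have hm' : Measurable fun ω => ENNReal.ofReal (φ (X (u ++ [false]) ω)) :=
    (hm.comp (hX.measurable _)).ennreal_ofReal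
  have hψ : Measurable fun t : S × S × S => ENNReal.ofReal (φ t.2.1 + φ t.2.2) :=
    ((hm.comp measurable_snd.fst).add (hm.comp measurable_snd.snd)).ennreal_ofReal
  have e : ∀ x, ∫⁻ p, ENNReal.ofReal (φ p.1 + φ p.2) ∂(P x)
      = 2 * ENNReal.ofReal (actQ P φ x) := fun x => by
    have hs : Integrable (fun p : S × S => φ p.1 + φ p.2) (P x) :=
      (hF.integrable_fst hφ x).add (hF.integrable_snd hφ x)
    rw [← ofReal_integral_eq_lintegral_ofReal hs
      (Eventually.of_forall fun p => add_nonneg (h0 _) (h0 _)), hF.actQ_eq hφ,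
      ← ENNReal.ofReal_ofNat 2, ← ENNReal.ofReal_mul zero_le_two, ← mul_assoc]
    norm_num
  calc _ = ∫⁻ ω, ENNReal.ofReal (φ (triangle X u ω).2.1 + φ (triangle X u ω).2.2) ∂ρ := by
        rw [← lintegral_add_left hm']
        exact lintegral_congr fun ω => (ENNReal.ofReal_add (h0 _) (h0 _)).symm
    _ = _ := by
        rw [hX.lintegral_triangle u hψ]
        simp only [e]
        rw [lintegral_const_mul]
        exact ((hF.measurable _ (hF.actQ_mem hφ)).comp (hX.measurable u)).ennreal_ofReal

/-- The many-to-one formula. -/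
theorem sum_lintegral_gen {φ : S → ℝ} (hφ : φ ∈ F) (h0 : ∀ x, 0 ≤ φ x) (k : ℕ) :
    ∑ u ∈ gen k, ∫⁻ ω, ENNReal.ofReal (φ (X u ω)) ∂ρ
      = 2 ^ k * ∫⁻ x, ENNReal.ofReal ((actQ P)^[k] φ x) ∂ν := by
  induction k generalizing φ with
  | zero =>
    rw [gen_zero, Finset.sum_singleton, pow_zero, one_mul, ← hX.initial, Function.iterate_zero,
      id, lintegral_map (hF.measurable φ hφ).ennreal_ofReal (hX.measurable _)]
  | succ k ih =>
    rw [sum_gen_succ]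
    simp only [hX.lintegral_daughters hF hφ h0]
    rw [← Finset.mul_sum, ih (hF.actQ_mem hφ) fun x => integral_nonneg h0, ← mul_assoc,
      pow_succ', Function.iterate_succ_apply]

theorem sum_lintegral_gen_le {φ G : S → ℝ} (hφ : φ ∈ F) (h0 : ∀ x, 0 ≤ φ x)
    (hG : Integrable G ν) (h : ∀ k x, |(actQ P)^[k] φ x| ≤ G x) (k : ℕ) :
    ∑ u ∈ gen k, ∫⁻ ω, ENNReal.ofReal (φ (X u ω)) ∂ρ ≤ ENNReal.ofReal (2 ^ k * ∫ x, G x ∂ν) := by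
  rw [hX.sum_lintegral_gen hF hφ h0, ENNReal.ofReal_mul (by positivity),
    ENNReal.ofReal_pow zero_le_two, ENNReal.ofReal_ofNat,
    ofReal_integral_eq_lintegral_ofReal hG
      (Eventually.of_forall fun x => (abs_nonneg _).trans (h 0 x))]
  gcongr with x
  exact (le_abs_self _).trans (h k x)

variable {J : Type*} [Fintype J] {μ : Measure S} {α : ℝ} {a : J → ℂ}
  {R : J → Module.End ℂ (complexSpan F)} {β : ℕ → ℝ} (hgap : SecondSpectralGap P F μ α a R β)

include hgap

theorem exists_sum_lintegral_gen_le {φ : S → ℝ} (hφ : φ ∈ F) (h0 : ∀ x, 0 ≤ φ x) :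
    ∃ C : ℝ, 0 ≤ C ∧ ∀ k, ∑ u ∈ gen k, ∫⁻ ω, ENNReal.ofReal (φ (X u ω)) ∂ρ
      ≤ ENNReal.ofReal (2 ^ k * C) := by
  obtain ⟨G, hG, h⟩ := hgap.exists_abs_iterate_le hF hφ
  exact ⟨_, integral_nonneg fun x => (abs_nonneg _).trans (h 0 x),
    hX.sum_lintegral_gen_le hF hφ h0 hG h⟩

/-- As `φ ^ 2` is in `F`, the many-to-one formula controls its sum over the whole generation, which
dominates the term at `u`. -/
theorem memLp_real {φ : S → ℝ} (hφ : φ ∈ F) (u : Tree) : MemLp (fun ω => φ (X u ω)) 2 ρ := by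
  obtain ⟨C, -, hC⟩ := hX.exists_sum_lintegral_gen_le hF hgap (hF.sq_mem φ hφ)
    fun x => sq_nonneg _
  have hm : Measurable fun ω => φ (X u ω) := (hF.measurable φ hφ).comp (hX.measurable u)
  rw [memLp_two_iff_integrable_sq hm.aestronglyMeasurable]
  refine ⟨(hm.pow_const 2).aestronglyMeasurable, ?_⟩
  rw [hasFiniteIntegral_iff_ofReal (Eventually.of_forall fun ω => sq_nonneg _)]
  exact ((Finset.single_le_sum
    (f := fun u => ∫⁻ ω, ENNReal.ofReal (φ (X u ω) ^ 2) ∂ρ) (fun _ _ => zero_le)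
    (mem_gen.2 rfl)).trans (hC u.length)).trans_lt ENNReal.ofReal_lt_top

theorem memLp_complex (h : complexSpan F) (u : Tree) :
    MemLp (fun ω => (h : S → ℂ) (X u ω)) 2 ρ := by
  obtain ⟨g, hg, hgh⟩ := hF.exists_norm_le h
  exact (hX.memLp_real hF hgap hg u).mono
    ((hF.measurable_complex h).comp (hX.measurable u)).aestronglyMeasurable
    (Eventually.of_forall fun ω => (hgh _).trans (le_abs_self _))

theorem memLp_genSum (h : complexSpan F) (n : ℕ) : MemLp (genSum X (h : S → ℂ) n) 2 ρ :=
  memLp_finsetSum _ fun u _ => hX.memLp_complex hF hgap h u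

omit hgap in
-- For `f (x, y, z) = φ y + φ z` one has `P f = 2 Q φ`, so the increment is a sum of conditionally
-- centred triangles. The factor `4` comes from `(y + z) ^ 2 ≤ 2 (y ^ 2 + z ^ 2)` and the `1/2` in
-- `Q`.
theorem lintegral_sq_increment_le {φ : S → ℝ} (hφ : φ ∈ F) {g : S → ℝ} (hg : g ∈ F) {c : ℝ}
    (h : ∀ x, φ x ^ 2 ≤ c ^ 2 * g x ^ 2) (k : ℕ) :
    ∫⁻ ω, ‖∑ u ∈ gen (k + 1), φ (X u ω) - 2 * ∑ u ∈ gen k, actQ P φ (X u ω)‖ₑ ^ 2 ∂ρ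
      ≤ ENNReal.ofReal (4 * c ^ 2)
        * ∑ u ∈ gen k, ∫⁻ ω, ENNReal.ofReal (actQ P (fun x => g x ^ 2) (X u ω)) ∂ρ := by
  have hm := hF.measurable φ hφ
  set f : S × S × S → ℝ := fun t => φ t.2.1 + φ t.2.2 with hf
  have hfm : Measurable f := (hm.comp measurable_snd.fst).add (hm.comp measurable_snd.snd)
  have hi1 := hF.integrable_fst (hF.sq_mem φ hφ)
  have hi2 := hF.integrable_snd (hF.sq_mem φ hφ)
  have hle : ∀ x p, f (x, p) ^ 2 ≤ 2 * (φ p.1 ^ 2 + φ p.2 ^ 2) := fun x p => by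
    simp only [hf]
    nlinarith [sq_nonneg (φ p.1 - φ p.2)]
  have hi : ∀ x, Integrable (fun p => f (x, p)) (P x) := fun x =>
    (hF.integrable_fst hφ x).add (hF.integrable_snd hφ x)
  have hisq : ∀ x, Integrable (fun p => f (x, p) ^ 2) (P x) := fun x => by
    refine Integrable.mono' (((hi1 x).add (hi2 x)).const_mul 2)
      ((hfm.comp measurable_prodMk_left).pow_const 2).aestronglyMeasurable
      (Eventually.of_forall fun p => ?_)
    rw [Real.norm_of_nonneg (sq_nonneg _)]
    exact hle x p
  have hPf : ∀ x, actTriple P f x = 2 * actQ P φ x := fun x => by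
    rw [hF.actQ_eq hφ, ← mul_assoc]
    norm_num
    rfl
  have hPf2 : ∀ x, actTriple P (fun t => f t ^ 2) x
      ≤ 4 * c ^ 2 * actQ P (fun x => g x ^ 2) x := fun x => by
    have h1 : actTriple P (fun t => f t ^ 2) x ≤ 4 * actQ P (fun y => φ y ^ 2) x := by
      rw [hF.actQ_eq (hF.sq_mem φ hφ)]
      refine (integral_mono (hisq x) (((hi1 x).add (hi2 x)).const_mul 2) (hle x)).trans_eq ?_
      rw [integral_const_mul]
      ring_nf
      rfl
    have h2 : actQ P (fun y => φ y ^ 2) x ≤ c ^ 2 * actQ P (fun x => g x ^ 2) x := by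
      refine (hF.actQ_mono (hF.sq_mem φ hφ) (F.smul_mem (c ^ 2) (hF.sq_mem g hg)) h x).trans_eq ?_
      exact integral_const_mul _ _
    linarith
  have e : ∀ ω, ∑ u ∈ gen (k + 1), φ (X u ω) - 2 * ∑ u ∈ gen k, actQ P φ (X u ω)
      = ∑ u ∈ gen k, (f (triangle X u ω) - actTriple P f (X u ω)) := fun ω => by
    rw [sum_gen_succ, Finset.mul_sum, ← Finset.sum_sub_distrib]
    exact Finset.sum_congr rfl fun u _ => by rw [hPf]; rfl
  simp_rw [e]
  refine (hX.lintegral_sq_sum_le hfm hi hisq k).trans ?_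
  rw [Finset.mul_sum]
  refine Finset.sum_le_sum fun u _ => ?_
  have hmg : Measurable fun ω => ENNReal.ofReal (actQ P (fun x => g x ^ 2) (X u ω)) :=
    ((hF.measurable _ (hF.actQ_mem (hF.sq_mem g hg))).comp (hX.measurable u)).ennreal_ofReal
  rw [← lintegral_const_mul _ hmg]
  refine lintegral_mono fun ω => ?_
  dsimp only
  rw [← ENNReal.ofReal_mul (by positivity)]
  exact ENNReal.ofReal_le_ofReal (hPf2 _)

/-- The second moments of one generation total `O(2 ^ k)`, whence `√2 ^ k`. The constant depends on
`h` only through `g`, which later gives uniformity. -/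
theorem exists_eLpNorm_increment_le {g : S → ℝ} (hg : g ∈ F) : ∃ C : ℝ, 0 ≤ C ∧
    ∀ (k : ℕ) (c : ℝ) (h : complexSpan F), 0 ≤ c → (∀ x, ‖(h : S → ℂ) x‖ ≤ c * g x) →
      eLpNorm (fun ω => genSum X (h : S → ℂ) (k + 1) ω
        - 2 * genSum X (hF.qEnd h : S → ℂ) k ω) 2 ρ ≤ ENNReal.ofReal (C * (c * √2 ^ k)) := by
  obtain ⟨C, hC0, hC⟩ := hX.exists_sum_lintegral_gen_le hF hgap (hF.actQ_mem (hF.sq_mem g hg))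
    fun x => integral_nonneg fun y => sq_nonneg _
  -- `8 = 4 + 4`: one variance bound each for the real and imaginary parts.
  refine ⟨√(8 * C), Real.sqrt_nonneg _, fun k c h hc hh => eLpNorm_two_le (by positivity) ?_⟩
  have hsq : ∀ x, ((h : S → ℂ) x).re ^ 2 ≤ c ^ 2 * g x ^ 2
      ∧ ((h : S → ℂ) x).im ^ 2 ≤ c ^ 2 * g x ^ 2 := fun x => by
    rw [← mul_pow]
    refine ⟨sq_le_sq.2 ((Complex.abs_re_le_norm _).trans ((hh x).trans (le_abs_self _))),
      sq_le_sq.2 ((Complex.abs_im_le_norm _).trans ((hh x).trans (le_abs_self _)))⟩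
  have h1 := hX.lintegral_sq_increment_le hF (re_mem h) hg (fun x => (hsq x).1) k
  have h2 := hX.lintegral_sq_increment_le hF (im_mem h) hg (fun x => (hsq x).2) k
  have e : ∀ ω, ‖genSum X (h : S → ℂ) (k + 1) ω - 2 * genSum X (hF.qEnd h : S → ℂ) k ω‖ₑ ^ 2
      = ‖∑ u ∈ gen (k + 1), ((h : S → ℂ) (X u ω)).re
          - 2 * ∑ u ∈ gen k, actQ P (fun x => ((h : S → ℂ) x).re) (X u ω)‖ₑ ^ 2
        + ‖∑ u ∈ gen (k + 1), ((h : S → ℂ) (X u ω)).im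
          - 2 * ∑ u ∈ gen k, actQ P (fun x => ((h : S → ℂ) x).im) (X u ω)‖ₑ ^ 2 := fun ω => by
    rw [enorm_sq_complex]
    simp [genSum, hF.coe_qEnd, hF.re_actQ, hF.im_actQ]
  simp_rw [e]
  rw [lintegral_add_left]
  · refine (add_le_add (h1.trans (mul_le_mul_right (hC k) _))
      (h2.trans (mul_le_mul_right (hC k) _))).trans_eq ?_
    rw [← ENNReal.ofReal_mul (by positivity), ← ENNReal.ofReal_add (by positivity) (by positivity)]
    congr 1
    rw [mul_pow, mul_pow, Real.sq_sqrt (by positivity), ← pow_mul, mul_comm k, pow_mul,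
      Real.sq_sqrt zero_le_two]
    ring
  · refine ((Finset.measurable_fun_sum _ fun u _ => ?_).sub
      ((Finset.measurable_fun_sum _ fun u _ => ?_).const_mul 2)).enorm.pow_const 2
    · exact (hF.measurable _ (re_mem h)).comp (hX.measurable u)
    · exact (hF.measurable _ (hF.actQ_mem (re_mem h))).comp (hX.measurable u)

/-- An `L²` bound for the sum over a generation, from the decay of the iterates of `Q`. -/
theorem exists_eLpNorm_genSum_le {g : S → ℝ} (hg : g ∈ F) : ∃ C : ℝ, 0 ≤ C ∧
    ∀ (n : ℕ) (c : ℕ → ℝ) (h : complexSpan F), (∀ m, 0 ≤ c m) →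
      (∀ m x, ‖((hF.qEnd ^ m) h : S → ℂ) x‖ ≤ c m * g x) →
      eLpNorm (genSum X (h : S → ℂ) n) 2 ρ
        ≤ ENNReal.ofReal (C * ∑ i ∈ Finset.range (n + 1), 2 ^ i * √2 ^ (n - i) * c i) := by
  obtain ⟨C, hC0, hC⟩ := hX.exists_eLpNorm_increment_le hF hgap hg
  -- `D` handles the root and `C` the noise of the later generations.
  set D := (eLpNorm (fun ω => g (X [] ω)) 2 ρ).toReal with hD
  refine ⟨max C D, le_max_of_le_left hC0, fun n => ?_⟩
  induction n with
  | zero =>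
    intro c h hc hh
    have h1 : eLpNorm (genSum X (h : S → ℂ) 0) 2 ρ
        ≤ eLpNorm (fun ω => c 0 * g (X [] ω)) 2 ρ :=
      eLpNorm_mono_real fun ω => by rw [genSum_zero]; exact hh 0 _
    refine h1.trans ?_
    have h2 := eLpNorm_const_smul_le (c := c 0) (f := fun ω => g (X [] ω)) (p := 2) (μ := ρ)
    refine h2.trans ?_
    rw [← ENNReal.ofReal_toReal (hX.memLp_real hF hgap hg []).eLpNorm_ne_top, ← hD,
      ← ofReal_norm, Real.norm_of_nonneg (hc 0), ← ENNReal.ofReal_mul (hc 0)]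
    refine ENNReal.ofReal_le_ofReal ?_
    simp only [zero_add, Finset.range_one, Finset.sum_singleton, pow_zero, Nat.sub_self, one_mul]
    rw [mul_comm]
    exact mul_le_mul_of_nonneg_right (le_max_right _ _) (hc 0)
  | succ n ih =>
    intro c h hc hh
    -- Generation `n + 1` of `h` is noise plus twice generation `n` of `Q h`. The noise supplies the
    -- term `i = 0`, and the doubled bound for `Q h` supplies the others, shifted by one.
    have h1 := ih (fun m => c (m + 1)) (hF.qEnd h) (fun m => hc _) fun m x => by
      rw [← Module.End.mul_apply, ← pow_succ]
      exact hh _ x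
    have h2 := hC n (c 0) h (hc 0) (hh 0)
    have e : genSum X (h : S → ℂ) (n + 1)
        = (fun ω => genSum X (h : S → ℂ) (n + 1) ω - 2 * genSum X (hF.qEnd h : S → ℂ) n ω)
          + (2 : ℂ) • genSum X (hF.qEnd h : S → ℂ) n := by
      ext ω
      simp
    rw [e]
    have hm1 := (measurable_genSum hX.measurable hF (hF.qEnd h) n)
    have hm2 := (measurable_genSum hX.measurable hF h (n + 1)).sub (hm1.const_mul 2)
    refine (eLpNorm_add_le hm2.aestronglyMeasurable (hm1.const_smul _).aestronglyMeasurable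
      (by norm_num)).trans ?_
    have h3 : eLpNorm ((2 : ℂ) • genSum X (hF.qEnd h : S → ℂ) n) 2 ρ ≤ ENNReal.ofReal
        (2 * (max C D * ∑ i ∈ Finset.range (n + 1), 2 ^ i * √2 ^ (n - i) * c (i + 1))) := by
      refine eLpNorm_const_smul_le.trans ?_
      rw [ENNReal.ofReal_mul zero_le_two, ← ofReal_norm]
      refine mul_le_mul' ?_ h1
      simp
    refine (add_le_add h2 h3).trans ?_
    have hs : 0 ≤ ∑ i ∈ Finset.range (n + 1), 2 ^ i * √2 ^ (n - i) * c (i + 1) :=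
      Finset.sum_nonneg fun i _ => mul_nonneg (by positivity) (hc _)
    have hM : 0 ≤ max C D := le_max_of_le_left hC0
    rw [← ENNReal.ofReal_add (mul_nonneg hC0 (mul_nonneg (hc 0) (by positivity)))
      (by positivity)]
    refine ENNReal.ofReal_le_ofReal ?_
    rw [Finset.sum_range_succ' _ (n + 1), mul_add, add_comm]
    have h4 : C * (c 0 * √2 ^ n) ≤ max C D * (2 ^ 0 * √2 ^ (n + 1 - 0) * c 0) := by
      refine mul_le_mul (le_max_left _ _) ?_ (mul_nonneg (hc 0) (by positivity)) hM
      rw [pow_zero, one_mul, mul_comm, Nat.sub_zero]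
      exact mul_le_mul_of_nonneg_right (pow_le_pow_right₀
        (Real.one_le_sqrt.2 one_le_two) n.le_succ) (hc 0)
    refine add_le_add (le_of_eq ?_) h4
    rw [mul_left_comm, Finset.mul_sum]
    refine congrArg _ (Finset.sum_congr rfl fun i _ => ?_)
    rw [Nat.add_sub_add_right, pow_succ]
    ring

end IsBMC

end

/-! ### Convolutions with geometric sequences, and the threshold for `α` -/

theorem tendsto_sum_pow_mul {r : ℝ} (h0 : 0 ≤ r) (h1 : r < 1) {a : ℕ → ℝ}
    (ha : Tendsto a atTop (𝓝 0)) :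
    Tendsto (fun n => ∑ k ∈ Finset.range (n + 1), r ^ k * a (n - k)) atTop (𝓝 0) := by
  obtain ⟨M, hM⟩ := ha.bddAbove_range.imp fun M hM n => hM ⟨n, rfl⟩
  obtain ⟨M', hM'⟩ := ha.neg.bddAbove_range.imp fun M hM n => hM ⟨n, rfl⟩
  have hab : ∀ n, |a n| ≤ max M M' := fun n =>
    abs_le'.2 ⟨(hM n).trans (le_max_left _ _), (hM' n).trans (le_max_right _ _)⟩
  have hB : 0 ≤ max M M' := (abs_nonneg _).trans (hab 0)
  have e : ∀ n, ∑ k ∈ Finset.range (n + 1), r ^ k * a (n - k)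
      = ∑' k, if k < n + 1 then r ^ k * a (n - k) else 0 := fun n => by
    rw [tsum_eq_sum (s := Finset.range (n + 1)) fun k hk => if_neg (by simpa using hk)]
    exact Finset.sum_congr rfl fun k hk => (if_pos (Finset.mem_range.1 hk)).symm
  simp_rw [e]
  suffices h : Tendsto (fun n => ∑' k, if k < n + 1 then r ^ k * a (n - k) else 0) atTop
      (𝓝 (∑' _ : ℕ, (0 : ℝ))) by
    rwa [tsum_zero] at h
  -- Each term tends to `0` for fixed `k`, and a null sequence is bounded, so a geometric series
  -- dominates.
  refine tendsto_tsum_of_dominated_convergence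
    ((summable_geometric_of_lt_one h0 h1).mul_right (max M M')) (fun k => ?_)
    (Eventually.of_forall fun n k => ?_)
  · have h2 : Tendsto (fun n => r ^ k * a (n - k)) atTop (𝓝 0) := by
      simpa using (ha.comp (tendsto_sub_atTop_nat k)).const_mul (r ^ k)
    refine h2.congr' ?_
    filter_upwards [eventually_ge_atTop k] with n hn
    rw [if_pos (by omega)]
  · split_ifs
    · rw [norm_mul, Real.norm_of_nonneg (pow_nonneg h0 k)]
      exact mul_le_mul_of_nonneg_left (hab _) (pow_nonneg h0 k)
    · rw [norm_zero]
      exact mul_nonneg (pow_nonneg h0 k) hB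

theorem tendsto_sum_pow_sub_mul {r : ℝ} (h0 : 0 ≤ r) (h1 : r < 1) {a : ℕ → ℝ}
    (ha : Tendsto a atTop (𝓝 0)) :
    Tendsto (fun n => ∑ k ∈ Finset.range (n + 1), r ^ (n - k) * a k) atTop (𝓝 0) := by
  refine (tendsto_sum_pow_mul h0 h1 ha).congr fun n => ?_
  rw [← Finset.sum_range_reflect]
  refine Finset.sum_congr rfl fun k hk => ?_
  have : k ≤ n := Nat.lt_succ_iff.1 (Finset.mem_range.1 hk)
  simp only [Nat.add_sub_cancel]
  rw [Nat.sub_sub_self this]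

theorem ratio_pos {α : ℝ} (hα0 : 0 < α) : 0 < √2 / (2 * α) := by positivity

/-- This is the ratio per generation of noise growth to drift growth. -/
theorem ratio_lt_one {α : ℝ} (hα0 : 0 < α) (hα : 1 / √2 < α) : √2 / (2 * α) < 1 := by
  rw [div_lt_iff₀ (by positivity)] at hα
  rw [div_lt_one (by positivity)]
  nlinarith [Real.sq_sqrt zero_le_two, Real.sqrt_nonneg 2, Real.sqrt_pos.2 (zero_lt_two (α := ℝ))]

theorem one_lt_two_mul {α : ℝ} (hα0 : 0 < α) (hα : 1 / √2 < α) : 1 < 2 * α := by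
  rw [div_lt_iff₀ (by positivity)] at hα
  nlinarith [Real.sq_sqrt zero_le_two, Real.sqrt_nonneg 2, mul_pos hα0 hα0]

/-! ### Sequences with geometrically small increments -/

section

variable {Ω E : Type*} [MeasurableSpace Ω] {ρ : Measure Ω} [NormedAddCommGroup E]
  {p : ℝ≥0∞} {M : ℕ → Ω → E} {C r : ℝ}

theorem eLpNorm_sub_le_of_geometric (hp : 1 ≤ p) (hM : ∀ n, AEStronglyMeasurable (M n) ρ)
    (hC : 0 ≤ C) (h0 : 0 < r) (h1 : r < 1)
    (h : ∀ n, eLpNorm (M (n + 1) - M n) p ρ ≤ ENNReal.ofReal (C * r ^ n)) {n m : ℕ}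
    (hnm : n ≤ m) : eLpNorm (M m - M n) p ρ ≤ ENNReal.ofReal (C / (1 - r) * r ^ n) := by
  obtain ⟨k, rfl⟩ := Nat.exists_eq_add_of_le hnm
  have h1' : 0 < 1 - r := sub_pos.2 h1
  -- The induction on `k` closes with the exact partial geometric sum, not with its upper bound.
  have key : eLpNorm (M (n + k) - M n) p ρ
      ≤ ENNReal.ofReal (C / (1 - r) * (r ^ n - r ^ (n + k))) := by
    clear hnm
    induction k with
    | zero => simp
    | succ k ih =>
      have e : M (n + (k + 1)) - M n = (M (n + k + 1) - M (n + k)) + (M (n + k) - M n) := by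
        rw [← add_assoc]
        abel
      have hr : r ^ (n + k) ≤ r ^ n := pow_le_pow_of_le_one h0.le h1.le (Nat.le_add_right n k)
      rw [e]
      refine (eLpNorm_add_le ((hM _).sub (hM _)) ((hM _).sub (hM _)) hp).trans
        ((add_le_add (h _) ih).trans_eq ?_)
      rw [← ENNReal.ofReal_add (by positivity)
        (mul_nonneg (by positivity) (sub_nonneg.2 hr))]
      congr 1
      field_simp
      ring
  refine key.trans (ENNReal.ofReal_le_ofReal (mul_le_mul_of_nonneg_left ?_ (by positivity)))
  exact sub_le_self _ (pow_nonneg h0.le _)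

theorem ae_tendsto_limUnder_of_geometric [CompleteSpace E] [Nonempty E] (hp : 1 ≤ p)
    (hM : ∀ n, AEStronglyMeasurable (M n) ρ)
    (hC : 0 ≤ C) (h0 : 0 < r) (h1 : r < 1)
    (h : ∀ n, eLpNorm (M (n + 1) - M n) p ρ ≤ ENNReal.ofReal (C * r ^ n)) :
    ∀ᵐ ω ∂ρ, Tendsto (fun n => M n ω) atTop (𝓝 (limUnder atTop fun n => M n ω)) := by
  have hD : 0 ≤ C / (1 - r) := div_nonneg hC (sub_pos.2 h1).le
  -- The Cauchy criterion asks for strict inequalities, and `C` may be `0`; hence the `+ 1`.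
  have hlt : ∀ N, C / (1 - r) * r ^ N < (C / (1 - r) + 1) * r ^ N := fun N =>
    mul_lt_mul_of_pos_right (lt_add_one _) (pow_pos h0 N)
  have h2 : ∀ᵐ ω ∂ρ, ∃ l, Tendsto (fun n => M n ω) atTop (𝓝 l) := by
    refine Lp.ae_tendsto_of_cauchy_eLpNorm hM hp
      (B := fun N => ENNReal.ofReal ((C / (1 - r) + 1) * r ^ N)) ?_ fun N n m hn hm => ?_
    · rw [← ENNReal.ofReal_tsum_of_nonneg (fun n => by positivity)
        ((summable_geometric_of_lt_one h0.le h1).mul_left _)]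
      exact ENNReal.ofReal_ne_top
    · have hN : ∀ n, N ≤ n → ENNReal.ofReal (C / (1 - r) * r ^ n)
          < ENNReal.ofReal ((C / (1 - r) + 1) * r ^ N) := fun n hn =>
        (ENNReal.ofReal_lt_ofReal_iff (by positivity)).2 ((mul_le_mul_of_nonneg_left
          (pow_le_pow_of_le_one h0.le h1.le hn) hD).trans_lt (hlt N))
      rcases le_total n m with hnm | hnm
      · rw [eLpNorm_sub_comm]
        exact (eLpNorm_sub_le_of_geometric hp hM hC h0 h1 h hnm).trans_lt (hN n hn)
      · exact (eLpNorm_sub_le_of_geometric hp hM hC h0 h1 h hnm).trans_lt (hN m hm)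
  exact h2.mono fun ω hω => tendsto_nhds_limUnder hω

theorem eLpNorm_sub_lim_le_of_geometric (hp : 1 ≤ p)
    (hM : ∀ n, AEStronglyMeasurable (M n) ρ) (hC : 0 ≤ C) (h0 : 0 < r) (h1 : r < 1)
    (h : ∀ n, eLpNorm (M (n + 1) - M n) p ρ ≤ ENNReal.ofReal (C * r ^ n)) {L : Ω → E}
    (hL : ∀ᵐ ω ∂ρ, Tendsto (fun n => M n ω) atTop (𝓝 (L ω))) (n : ℕ) :
    eLpNorm (M n - L) p ρ ≤ ENNReal.ofReal (C / (1 - r) * r ^ n) := by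
  rw [eLpNorm_sub_comm]
  -- Fatou's lemma as `m → ∞`, with `n` fixed.
  refine (Lp.eLpNorm_lim_le_liminf_eLpNorm (f := fun m => M m - M n)
    (fun m => (hM m).sub (hM n)) (L - M n) (hL.mono fun ω hω => hω.sub_const _)).trans ?_
  refine (liminf_le_liminf (v := fun _ => ENNReal.ofReal (C / (1 - r) * r ^ n)) ?_).trans ?_
  · filter_upwards [eventually_ge_atTop n] with m hm
    exact eLpNorm_sub_le_of_geometric hp hM hC h0 h1 h hm
  · simp

end

/-! ### The martingales and their limits -/

section

variable {Ω S J : Type*} {X : Tree → Ω → S} {F : Submodule ℝ (S → ℝ)} {a : J → ℂ}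
  {R : J → Module.End ℂ (complexSpan F)}

theorem mart_eq (X : Tree → Ω → S) (a : J → ℂ) (j : J) (f : F) (n : ℕ) (ω : Ω) :
    mart X a R j f n ω = ((2 * a j) ^ n)⁻¹ * genSum X (proj R j f) n ω := rfl

theorem measurable_mart [MeasurableSpace Ω] [MeasurableSpace S] {ν : Measure S}
    {P : Kernel S (S × S)} (hX : ∀ u, Measurable (X u)) (hF : IsTestSpace ν P F) (j : J) (f : F)
    (n : ℕ) : Measurable (mart X a R j f n) :=
  (measurable_genSum hX hF (R j (inSpan f)) n).const_mul _

end

section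

variable {Ω : Type*} [MeasurableSpace Ω] {ρ : Measure Ω}
  {S : Type*} [MeasurableSpace S] {ν : Measure S} {P : Kernel S (S × S)}
  {X : Tree → Ω → S} {F : Submodule ℝ (S → ℝ)}
  [IsProbabilityMeasure ρ] [IsMarkovKernel P]
  {J : Type*} [Fintype J] {μ : Measure S} {α : ℝ} {a : J → ℂ}
  {R : J → Module.End ℂ (complexSpan F)} {β : ℕ → ℝ}

namespace IsBMC

variable (hX : IsBMC ρ ν P X) (hF : IsTestSpace ν P F) (hgap : SecondSpectralGap P F μ α a R β)

include hX hF hgap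

theorem memLp_mart (j : J) (f : F) (n : ℕ) : MemLp (mart X a R j f n) 2 ρ :=
  (hX.memLp_genSum hF hgap (R j (inSpan f)) n).const_mul _

theorem genSum_eq_condExp (h : complexSpan F) (n : ℕ) :
    (fun ω => 2 * genSum X (hF.qEnd h : S → ℂ) n ω)
      =ᵐ[ρ] ρ[genSum X (h : S → ℂ) (n + 1) | treeSigma X n] := by
  have hint : ∀ k (h : complexSpan F), Integrable (genSum X (h : S → ℂ) k) ρ := fun k h =>
    (hX.memLp_genSum hF hgap h k).integrable (by norm_num)
  have hint1 : ∀ u (h : complexSpan F), Integrable (fun ω => (h : S → ℂ) (X u ω)) ρ := fun u h =>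
    (hX.memLp_complex hF hgap h u).integrable (by norm_num)
  have hm := hF.measurable_complex h
  refine ae_eq_condExp_of_forall_setIntegral_eq (treeSigma_le hX.measurable n) (hint _ _)
    (fun A _ _ => ((hint n _).const_mul 2).integrableOn) (fun A hA _ => ?_) ?_
  · set φ : S × S × S → ℂ := fun t => (h : S → ℂ) t.2.1 + (h : S → ℂ) t.2.2 with hφ
    have hφm : StronglyMeasurable φ :=
      ((hm.comp measurable_snd.fst).add (hm.comp measurable_snd.snd)).stronglyMeasurable
    have e : genSum X (h : S → ℂ) (n + 1)
        = fun ω => ∑ u ∈ gen n, φ (triangle X u ω) := funext fun ω => sum_gen_succ _ n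
    have hφi : ∀ u, Integrable (fun ω => φ (triangle X u ω)) ρ := fun u =>
      (hint1 _ h).add (hint1 _ h)
    -- The two daughters together have conditional mean `2 Q h`, as `Q` averages the two marginals.
    have e2 : ∀ x, ∫ p, φ (x, p) ∂(P x) = 2 * (hF.qEnd h : S → ℂ) x := fun x => by
      rw [hF.coe_qEnd, actQ_eq hm.stronglyMeasurable
        (integrable_complex_of (T := Prod.fst) (fun _ hf => hF.integrable_fst hf x) h)
        (integrable_complex_of (T := Prod.snd) (fun _ hf => hF.integrable_snd hf x) h)]
      rw [Complex.real_smul, ← mul_assoc]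
      norm_num
      rfl
    rw [e, integral_finsetSum _ fun u _ => (hφi u).integrableOn]
    simp only [genSum, Finset.mul_sum]
    rw [integral_finsetSum _ fun u _ => ((hint1 u _).const_mul 2).integrableOn]
    refine Finset.sum_congr rfl fun u hu => ?_
    rw [hX.setIntegral_triangle u hφm (hφi u) (by rwa [mem_gen.1 hu])]
    simp only [e2]
  · refine ((Finset.measurable_fun_sum _ fun u hu => ?_).const_mul (2 : ℂ)).aestronglyMeasurable
    exact (hF.measurable_complex _).comp (measurable_treeSigma X (mem_gen.1 hu).le)

/-- The conditional mean of the next generation sum of `R_j f` is `2 Q R_j f = 2 α_j R_j f` summed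
over the present one; the normalization cancels `2 α_j`. -/
theorem martingale_mart (j : J) (f : F) :
    Martingale (mart X a R j f) (treeFiltration X hX.measurable) ρ := by
  refine martingale_nat (fun n => ?_)
    (fun n => (hX.memLp_mart hF hgap j f n).integrable (by norm_num)) fun n => ?_
  · refine Measurable.stronglyMeasurable (Measurable.const_mul ?_ _)
    exact Finset.measurable_fun_sum _ fun u hu =>
      (hF.measurable_complex (R j (inSpan f))).comp (measurable_treeSigma X (mem_gen.1 hu).le)
  · have ha : a j ≠ 0 := fun h => by
      have := hgap.norm_eq j
      rw [h, norm_zero] at this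
      exact hgap.rate_pos.ne this
    have h1 := hX.genSum_eq_condExp hF hgap (R j (inSpan f)) n
    have h2 := condExp_smul (μ := ρ) ((2 * a j) ^ (n + 1))⁻¹
      (genSum X (R j (inSpan f) : S → ℂ) (n + 1)) (treeSigma X n)
    refine EventuallyEq.trans ?_ h2.symm
    filter_upwards [h1] with ω hω
    rw [Pi.smul_apply, ← hω, hgap.qEnd_proj, Submodule.coe_smul, genSum_smul, mart_eq,
      smul_eq_mul, pow_succ, mul_inv]
    change _ = ((2 * a j) ^ n)⁻¹ * (2 * a j)⁻¹ * (2 * (a j * genSum X (proj R j f) n ω))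
    field_simp

/-- Geometric bounds for the increments of the martingales, uniform in the function. -/
theorem exists_eLpNorm_mart_increment_le (hα : 1 / √2 < α) {g : S → ℝ} (hg : g ∈ F) :
    ∃ C : ℝ, 0 ≤ C ∧ ∀ (j : J) (f : F), (∀ x, ‖proj R j f x‖ ≤ g x) →
      eLpNorm (mart X a R j f 0) 2 ρ ≤ ENNReal.ofReal C ∧
      ∀ n, eLpNorm (mart X a R j f (n + 1) - mart X a R j f n) 2 ρ
        ≤ ENNReal.ofReal (C * (√2 / (2 * α)) ^ n) := by
  have hα0 := hgap.rate_pos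
  have h2α : 1 ≤ 2 * α := (one_lt_two_mul hα0 hα).le
  obtain ⟨C, hC0, hC⟩ := hX.exists_eLpNorm_increment_le hF hgap hg
  set D := (eLpNorm (fun ω => g (X [] ω)) 2 ρ).toReal with hD
  refine ⟨max C D, le_max_of_le_left hC0, fun j f hf => ⟨?_, fun n => ?_⟩⟩
  · refine (eLpNorm_mono_real (g := fun ω => g (X [] ω)) fun ω => ?_).trans ?_
    · rw [mart_eq, genSum_zero]
      simpa using hf _
    · rw [← ENNReal.ofReal_toReal (hX.memLp_real hF hgap hg []).eLpNorm_ne_top]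
      exact ENNReal.ofReal_le_ofReal (le_max_right _ _)
  · have ha : a j ≠ 0 := norm_pos_iff.1 (by rw [hgap.norm_eq]; exact hα0)
    have e : mart X a R j f (n + 1) - mart X a R j f n = ((2 * a j) ^ (n + 1))⁻¹ •
        (fun ω => genSum X (R j (inSpan f) : S → ℂ) (n + 1) ω
          - 2 * genSum X (hF.qEnd (R j (inSpan f)) : S → ℂ) n ω) := by
      ext ω
      rw [hgap.qEnd_proj, Submodule.coe_smul]
      simp only [Pi.sub_apply, Pi.smul_apply, genSum_smul, mart_eq, smul_eq_mul, mul_sub]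
      change _ = _ - ((2 * a j) ^ (n + 1))⁻¹ * (2 * (a j * genSum X (proj R j f) n ω))
      rw [pow_succ, mul_inv]
      congr 1
      field_simp
    rw [e]
    refine eLpNorm_const_smul_le.trans ((mul_le_mul_right (hC n 1 (R j (inSpan f)) zero_le_one
      fun x => by rw [one_mul]; exact hf x) _).trans ?_)
    rw [← ofReal_norm, ← ENNReal.ofReal_mul (norm_nonneg _)]
    refine ENNReal.ofReal_le_ofReal ?_
    rw [norm_inv, norm_pow, norm_mul, hgap.norm_eq, Complex.norm_ofNat, one_mul, div_pow,
      pow_succ, mul_inv]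
    calc ((2 * α) ^ n)⁻¹ * (2 * α)⁻¹ * (C * √2 ^ n)
        ≤ ((2 * α) ^ n)⁻¹ * 1 * (max C D * √2 ^ n) := by
          gcongr
          · exact inv_le_one_of_one_le₀ h2α
          · exact le_max_left _ _
      _ = _ := by ring

theorem ae_tendsto_mart (hα : 1 / √2 < α) (j : J) (f : F) :
    ∀ᵐ ω ∂ρ, Tendsto (fun n => mart X a R j f n ω) atTop (𝓝 (martLim X a R j f ω)) := by
  obtain ⟨g, hg, hfg⟩ := hF.exists_norm_le (R j (inSpan f))
  obtain ⟨C, hC0, hC⟩ := hX.exists_eLpNorm_mart_increment_le hF hgap hα hg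
  exact ae_tendsto_limUnder_of_geometric one_le_two
    (fun n => (measurable_mart hX.measurable hF j f n).aestronglyMeasurable) hC0
    (ratio_pos hgap.rate_pos) (ratio_lt_one hgap.rate_pos hα) (hC j f hfg).2

theorem aestronglyMeasurable_martLim (hα : 1 / √2 < α) (j : J) (f : F) :
    AEStronglyMeasurable (martLim X a R j f) ρ :=
  aestronglyMeasurable_of_tendsto_ae atTop
    (fun n => (measurable_mart hX.measurable hF j f n).aestronglyMeasurable)
    (hX.ae_tendsto_mart hF hgap hα j f)

theorem exists_eLpNorm_mart_sub_lim_le (hα : 1 / √2 < α) {g : S → ℝ} (hg : g ∈ F) :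
    ∃ C : ℝ, 0 ≤ C ∧ ∀ (j : J) (f : F), (∀ x, ‖proj R j f x‖ ≤ g x) →
      eLpNorm (martLim X a R j f) 2 ρ ≤ ENNReal.ofReal C ∧
      ∀ n, eLpNorm (mart X a R j f n - martLim X a R j f) 2 ρ
        ≤ ENNReal.ofReal (C * (√2 / (2 * α)) ^ n) := by
  obtain ⟨C, hC0, hC⟩ := hX.exists_eLpNorm_mart_increment_le hF hgap hα hg
  have h0 := ratio_pos hgap.rate_pos
  have h1 := ratio_lt_one hgap.rate_pos hα
  set r := √2 / (2 * α)
  have hD : 0 ≤ C / (1 - r) := div_nonneg hC0 (sub_pos.2 h1).le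
  refine ⟨C + C / (1 - r), add_nonneg hC0 hD, fun j f hf => ?_⟩
  have hm : ∀ n, AEStronglyMeasurable (mart X a R j f n) ρ := fun n =>
    (measurable_mart hX.measurable hF j f n).aestronglyMeasurable
  have hl := eLpNorm_sub_lim_le_of_geometric one_le_two hm hC0 h0 h1 (hC j f hf).2
    (hX.ae_tendsto_mart hF hgap hα j f)
  refine ⟨?_, fun n => (hl n).trans (ENNReal.ofReal_le_ofReal
    (mul_le_mul_of_nonneg_right (le_add_of_nonneg_left hC0) (pow_nonneg h0.le n)))⟩
  -- The limit is bounded by the root value plus the distance from it to the limit, both controlled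
  -- by `g` alone.
  have e : martLim X a R j f = mart X a R j f 0 - (mart X a R j f 0 - martLim X a R j f) := by
    abel
  rw [e]
  refine (eLpNorm_sub_le (hm 0) ((hm 0).sub (hX.aestronglyMeasurable_martLim hF hgap hα j f))
    one_le_two).trans ((add_le_add (hC j f hf).1 (hl 0)).trans_eq ?_)
  rw [← ENNReal.ofReal_add hC0 (by simpa using hD)]
  simp

theorem memLp_martLim (hα : 1 / √2 < α) (j : J) (f : F) : MemLp (martLim X a R j f) 2 ρ := by
  obtain ⟨g, hg, hfg⟩ := hF.exists_norm_le (R j (inSpan f))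
  obtain ⟨C, hC0, hC⟩ := hX.exists_eLpNorm_mart_sub_lim_le hF hgap hα hg
  exact ⟨hX.aestronglyMeasurable_martLim hF hgap hα j f,
    (hC j f hfg).1.trans_lt ENNReal.ofReal_lt_top⟩

theorem tendsto_eLpNorm_mart_sub_lim (hα : 1 / √2 < α) (j : J) (f : F) :
    Tendsto (fun n => eLpNorm (mart X a R j f n - martLim X a R j f) 2 ρ) atTop (𝓝 0) := by
  obtain ⟨g, hg, hfg⟩ := hF.exists_norm_le (R j (inSpan f))
  obtain ⟨C, hC0, hC⟩ := hX.exists_eLpNorm_mart_sub_lim_le hF hgap hα hg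
  refine tendsto_of_tendsto_of_tendsto_of_le_of_le tendsto_const_nhds ?_ (fun _ => zero_le)
    (hC j f hfg).2
  have := (tendsto_pow_atTop_nhds_zero_of_lt_one (ratio_pos hgap.rate_pos).le
    (ratio_lt_one hgap.rate_pos hα)).const_mul C
  rw [mul_zero] at this
  simpa using ENNReal.tendsto_ofReal this

end IsBMC

end

/-! ### Asymptotics of the fluctuations -/

theorem scaling_eq {α : ℝ} (hα : 0 < α) (n : ℕ) :
    (2 * α ^ 2) ^ (-(n : ℝ) / 2) * ((gen n).card : ℝ) ^ (-(1 / 2) : ℝ) = ((2 * α) ^ n)⁻¹ := by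
  have h1 : (2 * α ^ 2) ^ (-(n : ℝ) / 2) = ((2 * α ^ 2) ^ n) ^ (-(1 / 2) : ℝ) := by
    rw [← Real.rpow_natCast_mul (by positivity)]
    congr 1
    ring
  rw [h1, card_gen, Nat.cast_pow, Nat.cast_ofNat, ← Real.mul_rpow (by positivity) (by positivity),
    show (2 * α ^ 2) ^ n * 2 ^ n = ((2 * α) ^ n) ^ 2 by ring, Real.rpow_neg (by positivity),
    ← Real.sqrt_eq_rpow, Real.sqrt_sq (by positivity)]

/-- Factoring out the dominant rate turns the `L²` bound for a function decaying like `β i * α ^ i`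
into a geometric convolution with `β`, which tends to `0`. -/
theorem sum_pow_eq {α : ℝ} (β : ℕ → ℝ) (hα : 0 < α) (k : ℕ) :
    ∑ i ∈ Finset.range (k + 1), 2 ^ i * √2 ^ (k - i) * (β i * α ^ i)
      = (2 * α) ^ k * ∑ i ∈ Finset.range (k + 1), (√2 / (2 * α)) ^ (k - i) * β i := by
  rw [Finset.mul_sum]
  refine Finset.sum_congr rfl fun i hi => ?_
  obtain ⟨m, rfl⟩ := Nat.exists_eq_add_of_le (Nat.lt_succ_iff.1 (Finset.mem_range.1 hi))
  rw [Nat.add_sub_cancel_left, div_pow, pow_add, mul_pow 2 α i]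
  field_simp

section

variable {Ω E : Type*} [MeasurableSpace Ω] {ρ : Measure Ω} [NormedAddCommGroup E]
  [NormedSpace ℂ E]

theorem eLpNorm_sum_smul_le {p : ℝ≥0∞} (hp : 1 ≤ p) {Y : ℕ → ℕ → Ω → E}
    (hY : ∀ k l, AEStronglyMeasurable (Y k l) ρ) {b : ℕ → ℝ} (hb : ∀ k, 0 ≤ b k)
    (h : ∀ k l, eLpNorm (Y k l) p ρ ≤ ENNReal.ofReal (b k)) (c : ℂ) (n : ℕ) :
    eLpNorm (∑ l ∈ Finset.range (n + 1), c ^ l • Y (n - l) l) p ρ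
      ≤ ENNReal.ofReal (∑ l ∈ Finset.range (n + 1), ‖c‖ ^ l * b (n - l)) := by
  refine (eLpNorm_sum_le (fun l _ => (hY _ l).const_smul _) hp).trans ?_
  rw [ENNReal.ofReal_sum_of_nonneg fun l _ => mul_nonneg (by positivity) (hb _)]
  refine Finset.sum_le_sum fun l _ => eLpNorm_const_smul_le.trans ?_
  rw [ENNReal.ofReal_mul (by positivity), ← ofReal_norm, norm_pow]
  exact mul_le_mul_right (h _ _) _

end

section

variable {Ω : Type*} [MeasurableSpace Ω] {ρ : Measure Ω}
  {S : Type*} [MeasurableSpace S] {ν : Measure S} {P : Kernel S (S × S)}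
  {X : Tree → Ω → S} {F : Submodule ℝ (S → ℝ)}
  [IsProbabilityMeasure ρ] [IsMarkovKernel P]
  {J : Type*} [Fintype J] {μ : Measure S} {α : ℝ} {a : J → ℂ}
  {R : J → Module.End ℂ (complexSpan F)} {β : ℕ → ℝ}

namespace IsBMC

variable (hX : IsBMC ρ ν P X) (hF : IsTestSpace ν P F) (hgap : SecondSpectralGap P F μ α a R β)

include hX hF

/-- `L²` bound for the conditionally centered part of the fluctuations. -/
theorem exists_eLpNorm_sum_triangle_sub_le {f : ℕ → S × S × S → ℝ} (hf : ∀ l, Measurable (f l))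
    (hi : ∀ l x, Integrable (fun p => f l (x, p)) (P x))
    (hi2 : ∀ l x, Integrable (fun p => f l (x, p) ^ 2) (P x))
    (h₂ : ∀ l, actTriple P (fun t => f l t ^ 2) ∈ F) {g : S → ℝ} (hg : g ∈ F)
    (h : ∀ n l x, |(actQ P)^[n] (actTriple P (fun t => f l t ^ 2)) x| ≤ g x) :
    ∃ C : ℝ, 0 ≤ C ∧ ∀ k l,
      eLpNorm (fun ω => ∑ u ∈ gen k, (f l (triangle X u ω) - actTriple P (f l) (X u ω))) 2 ρ
        ≤ ENNReal.ofReal (C * √2 ^ k) := by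
  refine ⟨√(∫ x, g x ∂ν), Real.sqrt_nonneg _, fun k l => eLpNorm_two_le (by positivity) ?_⟩
  refine (hX.lintegral_sq_sum_le (hf l) (hi l) (hi2 l) k).trans
    ((hX.sum_lintegral_gen_le hF (h₂ l) (fun x => integral_nonneg fun p => sq_nonneg _)
      (hF.integrable_initial g hg) (fun k x => h k l x) k).trans_eq ?_)
  rw [mul_pow, Real.sq_sqrt (integral_nonneg fun x => (abs_nonneg _).trans (h 0 0 x)), ← pow_mul,
    mul_comm k, pow_mul, Real.sq_sqrt zero_le_two, mul_comm]

include hgap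

/-- In `L²`, a normalized generation sum is close to its limit, uniformly in the function. -/
theorem exists_eLpNorm_normalized_sub_le (hα : 1 / √2 < α) {f : ℕ → S × S × S → ℝ}
    (hf : ∀ l, Measurable (f l))
    (hi : ∀ l x, Integrable (fun p => f l (x, p)) (P x))
    (hi2 : ∀ l x, Integrable (fun p => f l (x, p) ^ 2) (P x))
    (h₁ : ∀ l, actTriple P (f l) ∈ F) (h₂ : ∀ l, actTriple P (fun t => f l t ^ 2) ∈ F)
    (hu₁ : UniformGap P μ α R β (fun l => ⟨actTriple P (f l), h₁ l⟩))
    (hu₂ : UniformGap P μ α R β (fun l => ⟨actTriple P (fun t => f l t ^ 2), h₂ l⟩)) :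
    ∃ b : ℕ → ℝ, (∀ k, 0 ≤ b k) ∧ Tendsto b atTop (𝓝 0) ∧ ∀ k l,
      eLpNorm (fun ω => ((2 * (α : ℂ)) ^ k)⁻¹ * ∑ u ∈ gen k,
          ((f l (triangle X u ω) - ∫ x, actTriple P (f l) x ∂μ : ℝ) : ℂ)
        - ∑ j, theta α a j ^ k * martLim X a R j ⟨actTriple P (f l), h₁ l⟩ ω) 2 ρ
        ≤ ENNReal.ofReal (b k) := by
  set h : ℕ → F := fun l => ⟨actTriple P (f l), h₁ l⟩ with hh
  have hα0 := hgap.rate_pos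
  have hr0 := ratio_pos hα0
  have hr1 := ratio_lt_one hα0 hα
  obtain ⟨g, hg, hgu⟩ := hu₁
  obtain ⟨g₂, hg₂, hgu₂⟩ := hu₂
  have hproj : ∀ j l x, ‖proj R j (h l) x‖ ≤ ((2 : ℝ) • g) x := fun j l x =>
    hgap.norm_proj_le_of_uniformGap hF (fun n l x => (hgu n l x).2) j l x
  obtain ⟨C₁, hC₁, hb₁⟩ := hX.exists_eLpNorm_sum_triangle_sub_le hF hf hi hi2 h₂ hg₂
    fun n l x => (hgu₂ n l x).1
  obtain ⟨C₂, hC₂, hb₂⟩ := hX.exists_eLpNorm_genSum_le hF hgap hg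
  obtain ⟨C₃, hC₃, hb₃⟩ := hX.exists_eLpNorm_mart_sub_lim_le hF hgap hα (F.smul_mem 2 hg)
  set r := √2 / (2 * α) with hr
  set ε : ℕ → ℝ := fun k => ∑ i ∈ Finset.range (k + 1), r ^ (k - i) * β i with hε
  have hε0 : ∀ k, 0 ≤ ε k := fun k => Finset.sum_nonneg fun i _ =>
    mul_nonneg (by positivity) (hgap.beta_pos i).le
  refine ⟨fun k => C₁ * r ^ k + C₂ * ε k + Fintype.card J * (C₃ * r ^ k), fun k => ?_, ?_,
    fun k l => ?_⟩
  · have := hε0 k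
    positivity
  · have e1 := tendsto_pow_atTop_nhds_zero_of_lt_one hr0.le hr1
    have e2 := tendsto_sum_pow_sub_mul hr0.le hr1 hgap.beta_tendsto
    simpa using ((e1.const_mul C₁).add (e2.const_mul C₂)).add
      ((e1.const_mul C₃).const_mul (Fintype.card J : ℝ))
  have hcm : centered μ (h l) ∈ F := F.sub_mem (h l).2 (hF.const_mem _)
  set hat' : complexSpan F := inSpan ⟨_, hcm⟩ - ∑ j, R j (inSpan (h l))
  have ehat : hat μ R (h l) = (hat' : S → ℂ) := by
    ext y
    simp [hat', hat, proj, inSpan, toComplex]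
  set c : ℂ := ((2 * (α : ℂ)) ^ k)⁻¹ with hc
  have hcn : ‖c‖ = ((2 * α) ^ k)⁻¹ := by
    rw [hc, norm_inv, norm_pow, norm_mul, Complex.norm_ofNat, Complex.norm_real,
      Real.norm_of_nonneg hα0.le]
  have hcpos : 0 < (2 * α) ^ k := by positivity
  set D : Ω → ℝ := fun ω => ∑ u ∈ gen k, (f l (triangle X u ω) - actTriple P (f l) (X u ω))
  have hDm : Measurable D := Finset.measurable_fun_sum _ fun u _ =>
    ((hf l).comp (measurable_triangle hX.measurable u)).sub
      ((measurable_actTriple P (hf l)).comp (hX.measurable u))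
  -- Three errors: the conditionally centred noise, the hat part, and the distance of each
  -- martingale from its limit.
  have hdecomp : (fun ω => c * ∑ u ∈ gen k,
        ((f l (triangle X u ω) - ∫ x, actTriple P (f l) x ∂μ : ℝ) : ℂ)
        - ∑ j, theta α a j ^ k * martLim X a R j (h l) ω)
      = (c • fun ω => (D ω : ℂ)) + c • genSum X (hat' : S → ℂ) k
        + ∑ j, theta α a j ^ k • (mart X a R j (h l) k - martLim X a R j (h l)) := by
    ext ω
    have e1 : ∑ u ∈ gen k, ((f l (triangle X u ω) - ∫ x, actTriple P (f l) x ∂μ : ℝ) : ℂ)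
        = D ω + genSum X (toComplex (centered μ (h l))) k ω := by
      simp only [D, genSum, Complex.ofReal_sum, ← Finset.sum_add_distrib]
      refine Finset.sum_congr rfl fun u _ => ?_
      simp only [toComplex, centered, h]
      push_cast
      ring
    have e2 : toComplex (centered μ (h l)) = (hat' : S → ℂ) + ∑ j, proj R j (h l) := by
      ext y
      simp [hat', proj, inSpan]
    -- The identity behind this is `(2 α) ^ (-k) = θ_j ^ k (2 α_j) ^ (-k)`.
    have e3 : ∀ j, c * genSum X (proj R j (h l)) k ω
        = theta α a j ^ k * mart X a R j (h l) k ω := fun j => by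
      have ha : a j ≠ 0 := norm_pos_iff.1 (by rw [hgap.norm_eq]; exact hα0)
      have hα' : (α : ℂ) ≠ 0 := by exact_mod_cast hα0.ne'
      rw [mart_eq, hc, theta, div_pow, mul_pow, mul_pow]
      field_simp
    rw [e1, e2, genSum_add, genSum_sum, mul_add, mul_add, Finset.mul_sum]
    simp only [e3, Pi.add_apply, Pi.smul_apply, smul_eq_mul, Finset.sum_apply, Pi.sub_apply,
      mul_sub, Finset.sum_sub_distrib]
    ring
  have hm1 : AEStronglyMeasurable (c • fun ω => (D ω : ℂ)) ρ :=
    ((Complex.measurable_ofReal.comp hDm).const_smul c).aestronglyMeasurable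
  have hm2 : AEStronglyMeasurable (c • genSum X (hat' : S → ℂ) k) ρ :=
    ((measurable_genSum hX.measurable hF hat' k).const_smul c).aestronglyMeasurable
  have hm3 : ∀ j ∈ Finset.univ, AEStronglyMeasurable
      (theta α a j ^ k • (mart X a R j (h l) k - martLim X a R j (h l))) ρ := fun j _ =>
    ((measurable_mart hX.measurable hF j (h l) k).aestronglyMeasurable.sub
      (hX.aestronglyMeasurable_martLim hF hgap hα j (h l))).const_smul _
  have hb1 : eLpNorm (c • fun ω => (D ω : ℂ)) 2 ρ ≤ ENNReal.ofReal (C₁ * r ^ k) := by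
    have e : eLpNorm (fun ω => (D ω : ℂ)) 2 ρ = eLpNorm D 2 ρ :=
      eLpNorm_congr_norm_ae (Eventually.of_forall fun ω => Complex.norm_real _)
    refine eLpNorm_const_smul_le.trans ?_
    rw [e, ← ofReal_norm, hcn]
    refine (mul_le_mul_right (hb₁ k l) _).trans_eq ?_
    rw [← ENNReal.ofReal_mul (by positivity), hr, div_pow]
    congr 1
    ring
  have hb2 : eLpNorm (c • genSum X (hat' : S → ℂ) k) 2 ρ ≤ ENNReal.ofReal (C₂ * ε k) := by
    refine eLpNorm_const_smul_le.trans ?_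
    rw [← ofReal_norm, hcn]
    refine (mul_le_mul_right (hb₂ k (fun m => β m * α ^ m) hat'
      (fun m => mul_nonneg (hgap.beta_pos m).le (by positivity)) fun m x => ?_) _).trans_eq ?_
    · rw [hF.coe_qEnd_pow, ← ehat]
      exact (hgu m l x).2.2
    · rw [← ENNReal.ofReal_mul (by positivity), sum_pow_eq β hα0]
      congr 1
      rw [mul_left_comm C₂, inv_mul_cancel_left₀ hcpos.ne']
  have hb3 : eLpNorm (∑ j, theta α a j ^ k • (mart X a R j (h l) k - martLim X a R j (h l))) 2 ρ
      ≤ ENNReal.ofReal (Fintype.card J * (C₃ * r ^ k)) := by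
    refine (eLpNorm_sum_le hm3 one_le_two).trans ((Finset.sum_le_sum
      (g := fun _ => ENNReal.ofReal (C₃ * r ^ k)) fun j _ => ?_).trans_eq ?_)
    · refine eLpNorm_const_smul_le.trans ?_
      rw [← ofReal_norm, norm_pow, hgap.norm_theta, one_pow, ENNReal.ofReal_one, one_mul]
      exact (hb₃ j (h l) fun x => hproj j l x).2 k
    · rw [Finset.sum_const, Finset.card_univ, nsmul_eq_mul, ENNReal.ofReal_mul (Nat.cast_nonneg _),
        ENNReal.ofReal_natCast]
  rw [hdecomp]
  refine (eLpNorm_add_le (hm1.add hm2) (Finset.aestronglyMeasurable_sum _ hm3)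
    one_le_two).trans ((add_le_add ((eLpNorm_add_le hm1 hm2 one_le_two).trans
      (add_le_add hb1 hb2)) hb3).trans_eq ?_)
  have := hε0 k
  rw [← ENNReal.ofReal_add (by positivity) (by positivity),
    ← ENNReal.ofReal_add (by positivity) (by positivity)]

/-- A summable dominating sequence for the series of the limits. -/
theorem exists_tsum_lintegral_limTerm (hα : 1 / √2 < α) {h : ℕ → F}
    (hu : UniformGap P μ α R β h) : ∃ Z : ℕ → Ω → ℝ≥0∞, (∀ l, AEMeasurable (Z l) ρ) ∧
      (∀ n ω l, ‖limTerm X α a R h n ω l‖ₑ ≤ Z l ω) ∧ ∑' l, ∫⁻ ω, Z l ω ∂ρ ≠ ∞ := by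
  have hα0 := hgap.rate_pos
  obtain ⟨g, hg, hgu⟩ := hu
  have hproj : ∀ j l x, ‖proj R j (h l) x‖ ≤ ((2 : ℝ) • g) x := fun j l x =>
    hgap.norm_proj_le_of_uniformGap hF (fun n l x => (hgu n l x).2) j l x
  obtain ⟨C, hC, hb⟩ := hX.exists_eLpNorm_mart_sub_lim_le hF hgap hα (F.smul_mem 2 hg)
  have hm : ∀ j l, AEStronglyMeasurable (martLim X a R j (h l)) ρ := fun j l =>
    hX.aestronglyMeasurable_martLim hF hgap hα j (h l)
  have hq1 : (2 * α)⁻¹ < 1 := inv_lt_one_of_one_lt₀ (one_lt_two_mul hα0 hα)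
  -- As `‖θ_j‖ = 1`, the powers of `θ_j`, negative ones included, drop out and the domination is
  -- independent of `n`.
  refine ⟨fun l ω => ENNReal.ofReal ((2 * α)⁻¹ ^ l) * ∑ j, ‖martLim X a R j (h l) ω‖ₑ,
    fun l => (Finset.aemeasurable_fun_sum _ fun j _ => (hm j l).enorm).const_mul _,
    fun n ω l => ?_, ?_⟩
  · rw [limTerm, enorm_mul]
    refine mul_le_mul' (le_of_eq ?_) ((enorm_sum_le _ _).trans
      (Finset.sum_le_sum fun j _ => le_of_eq ?_))
    · rw [← ofReal_norm, norm_inv, norm_pow, norm_mul, Complex.norm_ofNat, Complex.norm_real,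
        Real.norm_of_nonneg hα0.le, inv_pow]
    · rw [enorm_mul, ← ofReal_norm (theta α a j ^ _), norm_zpow, hgap.norm_theta, one_zpow,
        ENNReal.ofReal_one, one_mul]
  · refine ne_top_of_le_ne_top (b := ∑' l, ENNReal.ofReal ((2 * α)⁻¹ ^ l * (Fintype.card J * C)))
      ?_ (ENNReal.tsum_le_tsum fun l => ?_)
    · rw [← ENNReal.ofReal_tsum_of_nonneg (fun l => by positivity)
        ((summable_geometric_of_lt_one (by positivity) hq1).mul_right _)]
      exact ENNReal.ofReal_ne_top
    · rw [lintegral_const_mul'' _ (Finset.aemeasurable_fun_sum _ fun j _ => (hm j l).enorm),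
        lintegral_finsetSum' _ fun j _ => (hm j l).enorm, ENNReal.ofReal_mul (by positivity)]
      refine mul_le_mul_right ((Finset.sum_le_sum (g := fun _ => ENNReal.ofReal C)
        fun j _ => ?_).trans_eq ?_) _
      · rw [← eLpNorm_one_eq_lintegral_enorm]
        exact (eLpNorm_le_eLpNorm_of_exponent_le one_le_two (hm j l)).trans
          (hb j (h l) fun x => hproj j l x).1
      · rw [Finset.sum_const, Finset.card_univ, nsmul_eq_mul, ENNReal.ofReal_mul (Nat.cast_nonneg _),
          ENNReal.ofReal_natCast]

theorem aestronglyMeasurable_limTerm (hα : 1 / √2 < α) (h : ℕ → F) (n l : ℕ) :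
    AEStronglyMeasurable (fun ω => limTerm X α a R h n ω l) ρ :=
  (Finset.aestronglyMeasurable_fun_sum _ fun j _ =>
    (hX.aestronglyMeasurable_martLim hF hgap hα j (h l)).const_mul _).const_mul _

/-- The dominating series has finite expectation, hence is finite almost surely; as it does not
depend on `n`, one null set serves all `n`. -/
theorem ae_summable_limTerm (hα : 1 / √2 < α) {h : ℕ → F} (hu : UniformGap P μ α R β h) :
    ∀ᵐ ω ∂ρ, ∀ n, Summable (limTerm X α a R h n ω) := by
  obtain ⟨Z, hZm, hZ, hsum⟩ := hX.exists_tsum_lintegral_limTerm hF hgap hα hu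
  rw [← lintegral_tsum hZm] at hsum
  filter_upwards [ae_lt_top' (AEMeasurable.tsum hZm) hsum] with ω hω n
  refine Summable.of_enorm ?_
  exact ((ENNReal.tsum_le_tsum (hZ n ω)).trans_lt hω).ne

theorem tendsto_eLpNorm_tail (hα : 1 / √2 < α) {h : ℕ → F} (hu : UniformGap P μ α R β h) :
    Tendsto (fun n => eLpNorm (fun ω => ∑' l, limTerm X α a R h n ω (l + (n + 1))) 1 ρ)
      atTop (𝓝 0) := by
  obtain ⟨Z, hZm, hZ, hsum⟩ := hX.exists_tsum_lintegral_limTerm hF hgap hα hu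
  have h1 := (ENNReal.tendsto_sum_nat_add _ hsum).comp (tendsto_add_atTop_nat 1)
  refine tendsto_of_tendsto_of_tendsto_of_le_of_le tendsto_const_nhds h1 (fun _ => zero_le)
    fun n => ?_
  dsimp only [Function.comp]
  rw [eLpNorm_one_eq_lintegral_enorm, ← lintegral_tsum fun l => hZm _]
  exact lintegral_mono fun ω => enorm_tsum_le_tsum_enorm.trans
    (ENNReal.tsum_le_tsum fun l => hZ n ω _)

/-- Convergence in probability of the renormalized fluctuations. -/
theorem tendstoInMeasure_fluct (hα : 1 / √2 < α) {f : ℕ → S × S × S → ℝ}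
    (hf : ∀ l, Measurable (f l))
    (hi : ∀ l x, Integrable (fun p => f l (x, p)) (P x))
    (hi2 : ∀ l x, Integrable (fun p => f l (x, p) ^ 2) (P x))
    (h₁ : ∀ l, actTriple P (f l) ∈ F) (h₂ : ∀ l, actTriple P (fun t => f l t ^ 2) ∈ F)
    (hu₁ : UniformGap P μ α R β (fun l => ⟨actTriple P (f l), h₁ l⟩))
    (hu₂ : UniformGap P μ α R β (fun l => ⟨actTriple P (fun t => f l t ^ 2), h₂ l⟩)) :
    TendstoInMeasure ρ
      (fun (n : ℕ) ω => (((2 * α ^ 2) ^ (-(n : ℝ) / 2) * fluct P μ X f n ω : ℝ) : ℂ)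
        - ∑' l, limTerm X α a R (fun l => ⟨actTriple P (f l), h₁ l⟩) n ω l)
      atTop (fun _ => 0) := by
  have hα0 := hgap.rate_pos
  obtain ⟨b, hb0, hbt, hb⟩ :=
    hX.exists_eLpNorm_normalized_sub_le hF hgap hα hf hi hi2 h₁ h₂ hu₁ hu₂
  have htail := hX.tendsto_eLpNorm_tail hF hgap hα hu₁
  have hsum := hX.ae_summable_limTerm hF hgap hα hu₁
  have hlm := hX.aestronglyMeasurable_limTerm hF hgap hα (fun l => ⟨actTriple P (f l), h₁ l⟩)
  set h : ℕ → F := fun l => ⟨actTriple P (f l), h₁ l⟩ with hh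
  set Y : ℕ → ℕ → Ω → ℂ := fun k l ω => ((2 * (α : ℂ)) ^ k)⁻¹ * ∑ u ∈ gen k,
          ((f l (triangle X u ω) - ∫ x, actTriple P (f l) x ∂μ : ℝ) : ℂ)
        - ∑ j, theta α a j ^ k * martLim X a R j (h l) ω with hY
  have hYm : ∀ k l, AEStronglyMeasurable (Y k l) ρ := fun k l => by
    refine AEStronglyMeasurable.sub ?_ (Finset.aestronglyMeasurable_fun_sum _ fun j _ =>
      (hX.aestronglyMeasurable_martLim hF hgap hα j (h l)).const_mul _)
    refine ((Finset.measurable_fun_sum _ fun u _ => ?_).const_mul _).aestronglyMeasurable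
    exact Complex.measurable_ofReal.comp
      (((hf l).comp (measurable_triangle hX.measurable u)).sub_const _)
  set q : ℂ := (2 * (α : ℂ))⁻¹ with hq
  have hqn : ‖q‖ = (2 * α)⁻¹ := by
    rw [hq, norm_inv, norm_mul, Complex.norm_ofNat, Complex.norm_real,
      Real.norm_of_nonneg hα0.le]
  have hq1 : ‖q‖ < 1 := by
    rw [hqn]
    exact inv_lt_one_of_one_lt₀ (one_lt_two_mul hα0 hα)
  -- `T` gathers the errors for `l ≤ n`, each at generation `n - l`, and `V` is the tail of the
  -- series, `l > n`. The tail is controlled only in `L¹`, so the `L²` bound on `T` is weakened to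
  -- `L¹`.
  set T : ℕ → Ω → ℂ := fun n => ∑ l ∈ Finset.range (n + 1), q ^ l • Y (n - l) l
  set V : ℕ → Ω → ℂ := fun n ω => ∑' l, limTerm X α a R h n ω (l + (n + 1))
  have hTm : ∀ n, AEStronglyMeasurable (T n) ρ := fun n =>
    Finset.aestronglyMeasurable_sum _ fun l _ => (hYm _ _).const_smul _
  have hVm : ∀ n, AEStronglyMeasurable (V n) ρ := fun n => by
    refine aestronglyMeasurable_of_tendsto_ae atTop
      (f := fun N ω => ∑ l ∈ Finset.range N, limTerm X α a R h n ω (l + (n + 1)))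
      (fun N => Finset.aestronglyMeasurable_fun_sum _ fun l _ => hlm n _) ?_
    filter_upwards [hsum] with ω hω
    exact ((summable_nat_add_iff (n + 1)).2 (hω n)).hasSum.tendsto_sum_nat
  have hTt : Tendsto (fun n => eLpNorm (T n) 1 ρ) atTop (𝓝 0) := by
    have h1 := ENNReal.tendsto_ofReal (tendsto_sum_pow_mul (norm_nonneg q) hq1 hbt)
    rw [ENNReal.ofReal_zero] at h1
    exact tendsto_of_tendsto_of_tendsto_of_le_of_le tendsto_const_nhds h1 (fun _ => zero_le)
      fun n => (eLpNorm_le_eLpNorm_of_exponent_le one_le_two (hTm n)).trans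
        (eLpNorm_sum_smul_le one_le_two hYm hb0 hb q n)
  have hTV : TendstoInMeasure ρ (fun n => T n - V n) atTop (fun _ => (0 : ℂ)) := by
    refine tendstoInMeasure_of_tendsto_eLpNorm one_ne_zero (fun n => (hTm n).sub (hVm n))
      aestronglyMeasurable_const ?_
    have h2 := hTt.add htail
    rw [add_zero] at h2
    refine tendsto_of_tendsto_of_tendsto_of_le_of_le tendsto_const_nhds h2 (fun _ => zero_le)
      fun n => ?_
    refine le_trans (le_of_eq ?_) (eLpNorm_sub_le (hTm n) (hVm n) le_rfl)
    congr 1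
    ext ω
    exact sub_zero _
  refine hTV.congr_left fun n => ?_
  filter_upwards [hsum] with ω hω
  have hF1 : (((2 * α ^ 2) ^ (-(n : ℝ) / 2) * fluct P μ X f n ω : ℝ) : ℂ)
      = ∑ l ∈ Finset.range (n + 1), ((2 * (α : ℂ)) ^ n)⁻¹ * ∑ u ∈ gen (n - l),
          ((f l (triangle X u ω) - ∫ x, actTriple P (f l) x ∂μ : ℝ) : ℂ) := by
    rw [fluct, ← mul_assoc, scaling_eq hα0, ← Finset.mul_sum]
    push_cast
    rfl
  rw [hF1, ← (hω n).sum_add_tsum_nat_add (n + 1), ← sub_sub, ← Finset.sum_sub_distrib]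
  simp only [Pi.sub_apply, T, V, Finset.sum_apply, Pi.smul_apply, smul_eq_mul]
  congr 1
  refine Finset.sum_congr rfl fun l hl => ?_
  obtain ⟨m, rfl⟩ := Nat.exists_eq_add_of_le (Nat.lt_succ_iff.1 (Finset.mem_range.1 hl))
  simp only [hY, limTerm, Nat.add_sub_cancel_left]
  -- For `l ≤ n` the integer exponent of `θ_j` is the generation `m = n - l`, so the term matches
  -- the one subtracted in `Y`.
  have hz : (((l + m : ℕ) : ℤ) - (l : ℤ)) = (m : ℤ) := by push_cast; ring
  simp only [hz, zpow_natCast]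
  rw [mul_sub, hq, inv_pow, pow_add, mul_inv, mul_assoc]

end IsBMC

end

end BMC

theorem mainTheorem4 {S Ω J : Type*} [MeasurableSpace S] [MeasurableSpace Ω] [Fintype J]
    (ρ : Measure Ω) [IsProbabilityMeasure ρ]
    (ν : Measure S) [IsProbabilityMeasure ν]
    (P : Kernel S (S × S)) [IsMarkovKernel P]
    (X : BMC.Tree → Ω → S) (hX : BMC.IsBMC ρ ν P X)
    (F : Submodule ℝ (S → ℝ)) (hF : BMC.IsTestSpace ν P F)
    (μ : Measure S) (α : ℝ) (a : J → ℂ)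
    (R : J → Module.End ℂ (BMC.complexSpan F)) (β : ℕ → ℝ)
    (hgap : BMC.SecondSpectralGap P F μ α a R β)
    (hα : 1 / Real.sqrt 2 < α) :
    -- for `f` in `F`, `M_{n,j}(f)` is a martingale, converging a.s. and in `L²` to `M_{∞,j}(f)`
    (∀ (j : J) (f : F),
      Martingale (BMC.mart X a R j f) (BMC.treeFiltration X hX.measurable) ρ ∧
      (∀ᵐ ω ∂ρ, Tendsto (fun n => BMC.mart X a R j f n ω) atTop
        (𝓝 (BMC.martLim X a R j f ω))) ∧
      (∀ n, MemLp (BMC.mart X a R j f n) 2 ρ) ∧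
      MemLp (BMC.martLim X a R j f) 2 ρ ∧
      Tendsto (fun n => eLpNorm (BMC.mart X a R j f n - BMC.martLim X a R j f) 2 ρ)
        atTop (𝓝 0)) ∧
    ∀ f : ℕ → S × S × S → ℝ, (∀ l, Measurable (f l)) →
      (∀ l x, Integrable (fun p => f l (x, p)) (P x)) →
      (∀ l x, Integrable (fun p => f l (x, p) ^ 2) (P x)) →
      ∀ (h₁ : ∀ l, BMC.actTriple P (f l) ∈ F)
        (h₂ : ∀ l, BMC.actTriple P (fun t => f l t ^ 2) ∈ F),
        BMC.UniformGap P μ α R β (fun l => ⟨BMC.actTriple P (f l), h₁ l⟩) →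
        BMC.UniformGap P μ α R β (fun l => ⟨BMC.actTriple P (fun t => f l t ^ 2), h₂ l⟩) →
        (∀ᵐ ω ∂ρ, ∀ n, Summable
          (BMC.limTerm X α a R (fun l => ⟨BMC.actTriple P (f l), h₁ l⟩) n ω)) ∧
        TendstoInMeasure ρ
          (fun (n : ℕ) ω => (((2 * α ^ 2) ^ (-(n : ℝ) / 2) * BMC.fluct P μ X f n ω : ℝ) : ℂ)
            - ∑' l, BMC.limTerm X α a R (fun l => ⟨BMC.actTriple P (f l), h₁ l⟩) n ω l)
          atTop (fun _ => 0) := by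
  refine ⟨fun j f => ⟨hX.martingale_mart hF hgap j f, hX.ae_tendsto_mart hF hgap hα j f,
    hX.memLp_mart hF hgap j f, hX.memLp_martLim hF hgap hα j f,
    hX.tendsto_eLpNorm_mart_sub_lim hF hgap hα j f⟩, ?_⟩
  intro f hf hi hi2 h₁ h₂ hu₁ hu₂
  exact ⟨hX.ae_summable_limTerm hF hgap hα hu₁,
    hX.tendstoInMeasure_fluct hF hgap hα hf hi hi2 h₁ h₂ hu₁ hu₂⟩
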